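/- Consider the $Z_2$-equivariant planar cubic switching system with real parameters $a_{02},a_{03},a_{12},a_{21},b_{02},b_{03},b_{12},b_{21}$ and switching line the $x$-axis, $$ \begin{aligned} \dot x&=-a_{21}y\pm a_{02}y^2+a_{21}x^2y+a_{12}xy^2+a_{03}y^3,\\ \dot y&=-\tfrac{x}{2}-b_{21}y\pm b_{02}y^2+\tfrac{x^3}{2}+b_{21}x^2y+b_{12}xy^2+b_{03}y^3, \end{aligned} $$ where the sign $+$ (the upper system) is taken for $y>0$ and the sign $-$ (the lower system) for $y<0$; solutions are understood in the sense of Filippov. Suppose that one of the following conditions holds: - I: $a_{02}+a_{12}=a_{21}+b_{12}=a_{12}+3b_{03}=b_{02}=b_{21}=0$, $a_{12}>0$, $a_{03}+2a_{21}^2<0$; - II: $a_{02}=a_{12}=b_{02}=b_{03}=b_{21}=0$, $2a_{03}+(b_{12}-a_{21})^2<0$; - III: $a_{02}=a_{12}=b_{02}=a_{21}+b_{12}=3b_{03}+2a_{21}b_{21}=9(a_{03}+2a_{21}^2)^2+8a_{21}b_{21}^2(3a_{03}+2a_{21}^2)=0$, $a_{03}+2a_{21}^2<0$; - IV: $a_{02}=a_{12}=b_{02}=8a_{21}+3b_{21}^2=16a_{03}-3b_{21}^2(4b_{12}+b_{21}^2)=8b_{03}-b_{21}(8b_{12}-b_{21}^2)=0$,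 $-\tfrac{9+4\sqrt3}{8}b_{21}^2<b_{12}<-\tfrac{9-4\sqrt3}{8}b_{21}^2$; - V: $a_{12}=b_{02}=b_{03}=b_{21}=0$, $a_{02}<0$; - VI: $a_{21}+b_{12}=a_{12}+3b_{03}=b_{02}=b_{21}=0$, and either $a_{02}+|a_{12}|<0$, or $a_{02}=a_{12}<0$ and $a_{03}+2a_{21}^2<0$. Then the points $(\pm1,0)$ are isolated nilpotent singular points of both the upper and the lower vector field (isolated zeros at which the Jacobian matrix is nilpotent but not zero), and they form a bi-center of the switching system: each of $(1,0)$ and $(-1,0)$ is a center, that is, it has a neighbourhood which consists, apart from the point itself, of periodic orbits surrounding the point. -/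

import Mathlib

/-- A planar switching (piecewise smooth) system whose switching line is the `x`-axis: the vector
field `upper` acts on `y > 0` and the vector field `lower` acts on `y < 0`. -/
structure SwitchingSystem where
  /-- the vector field on the upper half-plane -/
  upper : ℝ × ℝ → ℝ × ℝ
  /-- the vector field on the lower half-plane -/
  lower : ℝ × ℝ → ℝ × ℝ

namespace SwitchingSystem

/-- The set of admissible velocities at a point, with the Filippov convention on the switching
line: there every convex combination of the two one-sided velocities is admissible. -/
noncomputable def velocities (S : SwitchingSystem) (p : ℝ × ℝ) : Set (ℝ × ℝ) :=
  if 0 < p.2 then {S.upper p}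
  else if p.2 < 0 then {S.lower p}
  else segment ℝ (S.upper p) (S.lower p)

/-- `γ` is a (Filippov) solution of the switching system on the interval `J`: it is an indefinite
integral of a locally integrable function (that is, it is absolutely continuous on compact
subintervals) whose value at almost every `t ∈ J` is an admissible velocity at `γ t`. -/
def IsSolutionOn (S : SwitchingSystem) (γ : ℝ → ℝ × ℝ) (J : Set ℝ) : Prop :=
  ∃ v : ℝ → ℝ × ℝ,
    (∀ a ∈ J, ∀ b ∈ J, IntervalIntegrable v MeasureTheory.volume a b ∧
      γ b - γ a = ∫ t in a..b, v t) ∧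
    ∀ᵐ t ∂(MeasureTheory.volume.restrict J), v t ∈ S.velocities (γ t)

/-- The point `p` is a center: some neighbourhood `U` of `p` consists, apart from `p`, of periodic
orbits surrounding `p`. Through every `q ∈ U`, `q ≠ p`, there passes a periodic solution that
stays in `U`, avoids `p` and surrounds `p` (the connected component of `p` in the complement of
the orbit is bounded, so in particular the orbit is not a single point), and every solution
through `q`, on any time interval, is a piece of that periodic solution. -/
def IsCenter (S : SwitchingSystem) (p : ℝ × ℝ) : Prop :=
  ∃ U ∈ nhds p, ∀ q ∈ U, q ≠ p →
    ∃ (γ : ℝ → ℝ × ℝ) (T : ℝ),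
      0 < T ∧ Function.Periodic γ T ∧
      S.IsSolutionOn γ Set.univ ∧ γ 0 = q ∧
      Set.range γ ⊆ U ∧
      p ∉ Set.range γ ∧ Bornology.IsBounded (connectedComponentIn (Set.range γ)ᶜ p) ∧
      ∀ (J : Set ℝ) (δ : ℝ → ℝ × ℝ), J.OrdConnected → 0 ∈ J →
        S.IsSolutionOn δ J → δ 0 = q → Set.EqOn δ γ J

/-- Invariance of the system under the rotation by `π` about the origin. -/
def IsZTwoEquivariant (S : SwitchingSystem) : Prop :=
  ∀ p : ℝ × ℝ, S.upper (-p) = -S.lower p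

/-- A `Z₂`-equivariant switching system has a bi-center at `e₁` and `e₂` if both are centers. -/
def HasBiCenter (S : SwitchingSystem) (e₁ e₂ : ℝ × ℝ) : Prop :=
  S.IsZTwoEquivariant ∧ S.IsCenter e₁ ∧ S.IsCenter e₂

end SwitchingSystem

/-- `p` is an isolated nilpotent singular point of the planar vector field `X`: the Jacobian at `p`
is nilpotent (both eigenvalues are zero) but not zero. -/
def IsNilpotentSingularPoint (X : ℝ × ℝ → ℝ × ℝ) (p : ℝ × ℝ) : Prop :=
  X p = 0 ∧ (∀ᶠ q in nhdsWithin p {p}ᶜ, X q ≠ 0) ∧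
    ∃ A : ℝ × ℝ →L[ℝ] ℝ × ℝ, HasFDerivAt X A p ∧ IsNilpotent A ∧ A ≠ 0

/-- The `Z₂`-equivariant cubic switching system whose upper and lower vector fields both have
Jacobian matrix `!![0, 0; 1, 0]` at `(1, 0)` and at `(-1, 0)`. -/
noncomputable def cubicSystem (a₀₂ a₀₃ a₁₂ a₂₁ b₀₂ b₀₃ b₁₂ b₂₁ : ℝ) : SwitchingSystem where
  upper := fun (x, y) =>
    (-a₂₁ * y + a₀₂ * y ^ 2 + a₂₁ * x ^ 2 * y + a₁₂ * x * y ^ 2 + a₀₃ * y ^ 3,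
     -x / 2 - b₂₁ * y + b₀₂ * y ^ 2 + x ^ 3 / 2 + b₂₁ * x ^ 2 * y + b₁₂ * x * y ^ 2
       + b₀₃ * y ^ 3)
  lower := fun (x, y) =>
    (-a₂₁ * y - a₀₂ * y ^ 2 + a₂₁ * x ^ 2 * y + a₁₂ * x * y ^ 2 + a₀₃ * y ^ 3,
     -x / 2 - b₂₁ * y - b₀₂ * y ^ 2 + x ^ 3 / 2 + b₂₁ * x ^ 2 * y + b₁₂ * x * y ^ 2
       + b₀₃ * y ^ 3)

/-! ### Abstract half-turn estimates in a half-plane. -/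

section HalfTurn

open Set Filter Topology Real

/-! Every condition contains `b₀₂ = 0`. The two fields then agree on the switching line, so there is
no sliding, and since `y * |y|` is `C¹` they glue to one `C¹` field, `cubicField`. Filippov
solutions are therefore classical solutions and are unique. What remains is to show that orbits near
`(1, 0)` turn around it and that they close up; equivariance carries the result to `(-1, 0)`.

Turning. With `u = x - 1` the upper field is `u' = -α y² + ...`, `y' = u + ...`, where `u` has
weight 2 and `y` weight 1. The lower field takes the same form after a half-rotation about the
point, with its own `α`. If `α > 0`, or if `α = 0` and a discriminant is negative, then `y u' - 2 u
y'` is negative definite in `u` and `y²` (`nil_rotation`), so the weighted slope `u / y²` decreases.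
The derivative of its arctangent is at most `-c y`, hence `∫ y dt ≤ π / c` along a half-turn. The
energy `u² + (2/3) α y³ + y⁴` has logarithmic derivative `O(y)` and so changes by a bounded factor
only. The product `u y` bounds the elapsed time. Thus small orbits cross from the positive to the
negative half-axis in finite time (`exists_half_turn`), and an orbit made of two such arcs is
star-shaped for the dilations `(u, y) ↦ (l² u, l y)`, which shows that it surrounds the point.

Closing. Four mechanisms make the orbit return to its starting point: a Hamiltonian in each
half-plane, the two agreeing on the axis (I, VI); the mirror symmetry `y ↦ -y` with time reversed
(II, V); a Darboux first integral built from a line and a cubic curve (III); a nonlinear reversing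
involution fixing the axis (IV). -/

theorem HasDerivAt.eventually_slope_pos {f : ℝ → ℝ} {d t : ℝ} (h : HasDerivAt f d t)
    (hd : 0 < d) : ∀ᶠ s in 𝓝[≠] t, 0 < (s - t) * (f s - f t) := by
  have h1 := (hasDerivAt_iff_tendsto_slope.1 h).eventually (lt_mem_nhds hd)
  filter_upwards [h1, self_mem_nhdsWithin] with s hs hst
  have hst' : s - t ≠ 0 := sub_ne_zero.2 hst
  have h2 : (s - t) * (f s - f t) = (s - t) ^ 2 * slope f t s := by
    rw [slope_def_field]; field_simp
  rw [h2]
  positivity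

theorem HasDerivAt.eventually_lt_right {f : ℝ → ℝ} {d t : ℝ} (h : HasDerivAt f d t)
    (hd : 0 < d) : ∀ᶠ s in 𝓝[>] t, f t < f s := by
  have h1 := h.eventually_slope_pos hd
  filter_upwards [h1.filter_mono (nhdsWithin_mono t fun s hs ↦ ne_of_gt hs),
    self_mem_nhdsWithin] with s hs hst
  have : 0 < s - t := sub_pos.2 hst
  nlinarith [(pos_iff_pos_of_mul_pos hs).1 this]

theorem HasDerivAt.eventually_lt_left {f : ℝ → ℝ} {d t : ℝ} (h : HasDerivAt f d t)
    (hd : 0 < d) : ∀ᶠ s in 𝓝[<] t, f s < f t := by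
  have h1 := h.eventually_slope_pos hd
  filter_upwards [h1.filter_mono (nhdsWithin_mono t fun s hs ↦ ne_of_lt hs),
    self_mem_nhdsWithin] with s hs hst
  have : s - t < 0 := sub_neg.2 hst
  nlinarith [(neg_iff_neg_of_mul_pos hs).1 this]

theorem monotoneOn_Ioo_of_hasDerivAt {f f' : ℝ → ℝ} {a b : ℝ}
    (h : ∀ t ∈ Ioo a b, HasDerivAt f (f' t) t) (h' : ∀ t ∈ Ioo a b, 0 ≤ f' t) :
    MonotoneOn f (Ioo a b) := by
  refine monotoneOn_of_hasDerivWithinAt_nonneg (convex_Ioo a b) (f' := f')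
    (fun t ht ↦ (h t ht).continuousAt.continuousWithinAt) ?_ ?_
  · rw [interior_Ioo]; exact fun t ht ↦ (h t ht).hasDerivWithinAt
  · rwa [interior_Ioo]

/-- Inside the open upper half-plane the weighted slope `u / y ^ 2` decreases, the energy `e`
changes by a bounded factor and the elapsed time is bounded. -/
theorem half_turn_bounds {c C D ε T : ℝ} (hc : 0 < c) (hC : 0 ≤ C) (hD : 0 < D)
    {u y e du dy de : ℝ → ℝ} (hec : Continuous e)
    (hest : ∀ t, 0 ≤ y t → e t < ε → HasDerivAt u (du t) t ∧ HasDerivAt y (dy t) t ∧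
      HasDerivAt e (de t) t ∧ y t * du t - 2 * u t * dy t ≤ -c * (u t ^ 2 + y t ^ 4) ∧
      |de t| ≤ C * y t * e t ∧ u t ^ 2 / 2 - C * y t ≤ u t * dy t + y t * du t)
    (hge : ∀ t, 0 ≤ y t → u t ^ 2 + y t ^ 4 ≤ e t)
    (hle : ∀ t, 0 ≤ y t → e t < ε → e t ≤ D * (u t ^ 2 + y t))
    (he0 : 0 < e 0) (hgood : ∀ t ∈ Ioo 0 T, 0 < y t ∧ e t < ε) :
    (∀ t ∈ Ioo 0 T, e t ≤ e 0 * exp (C / c * π) ∧ e 0 ≤ e t * exp (C / c * π)) ∧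
    (∀ a ∈ Ioo 0 T, ∀ b ∈ Ioo 0 T, a ≤ b → b - a ≤
      ((C + 1) / c * π + 2 * (1 + ε)) / (e 0 / (2 * D * exp (C / c * π)))) ∧
    StrictAntiOn (fun t ↦ u t / y t ^ 2) (Ioo 0 T) := by
  set k := C / c with hk
  -- This angle stays in an interval of length `π` and has derivative at most `-c * y`, so it
  -- controls every quantity whose derivative is bounded by a multiple of `y`.
  set A : ℝ → ℝ := fun t ↦ arctan (u t / y t ^ 2)
  set s' : ℝ → ℝ := fun t ↦ (du t * y t ^ 2 - u t * (2 * y t * dy t)) / (y t ^ 2) ^ 2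
  have hs' : ∀ t ∈ Ioo 0 T, HasDerivAt (fun t ↦ u t / y t ^ 2) (s' t) t := by
    intro t ht
    obtain ⟨hy, he⟩ := hgood t ht
    obtain ⟨h1, h2, -⟩ := hest t hy.le he
    have h3 : HasDerivAt (fun t ↦ y t ^ 2) (2 * y t * dy t) t := by
      simpa using h2.fun_pow 2
    exact h1.div h3 (by positivity)
  have hs'neg : ∀ t ∈ Ioo 0 T, s' t < 0 := by
    intro t ht
    obtain ⟨hy, he⟩ := hgood t ht
    obtain ⟨-, -, -, h4, -⟩ := hest t hy.le he
    have h5 : du t * y t ^ 2 - u t * (2 * y t * dy t) =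
        y t * (y t * du t - 2 * u t * dy t) := by ring
    simp only [s']
    rw [h5]
    apply div_neg_of_neg_of_pos _ (by positivity)
    apply mul_neg_of_pos_of_neg hy
    have : 0 < c * (u t ^ 2 + y t ^ 4) := by positivity
    linarith
  set A' : ℝ → ℝ := fun t ↦ 1 / (1 + (u t / y t ^ 2) ^ 2) * s' t
  have hA' : ∀ t ∈ Ioo 0 T, HasDerivAt A (A' t) t := fun t ht ↦ (hs' t ht).arctan
  have hA'le : ∀ t ∈ Ioo 0 T, A' t ≤ -(c * y t) := by
    intro t ht
    obtain ⟨hy, he⟩ := hgood t ht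
    obtain ⟨-, -, -, h4, -⟩ := hest t hy.le he
    have h5 : A' t = y t * (y t * du t - 2 * u t * dy t) / (u t ^ 2 + y t ^ 4) := by
      simp only [A', s']
      field_simp
      ring
    rw [h5, div_le_iff₀ (by positivity)]
    nlinarith
  have hAlt : ∀ t, -(π / 2) < A t ∧ A t < π / 2 := fun t ↦
    ⟨neg_pi_div_two_lt_arctan _, arctan_lt_pi_div_two _⟩
  have hepos : ∀ t ∈ Ioo 0 T, 0 < e t := by
    intro t ht
    obtain ⟨hy, he⟩ := hgood t ht
    have := hge t hy.le
    have : 0 < u t ^ 2 + y t ^ 4 := by positivity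
    linarith
  have hkc : k * c = C := by rw [hk]; field_simp
  have hk0 : 0 ≤ k := by positivity
  have hlog : ∀ t ∈ Ioo 0 T, HasDerivAt (fun t ↦ log (e t)) (de t / e t) t := by
    intro t ht
    obtain ⟨hy, he⟩ := hgood t ht
    exact (hest t hy.le he).2.2.1.log (hepos t ht).ne'
  have hlogle : ∀ t ∈ Ioo 0 T, |de t / e t| ≤ C * y t := by
    intro t ht
    obtain ⟨hy, he⟩ := hgood t ht
    rw [abs_div, abs_of_pos (hepos t ht), div_le_iff₀ (hepos t ht)]
    exact (hest t hy.le he).2.2.2.2.1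
  -- Both `log e - k * A` and `-log e - k * A` increase, because `k * c = C` balances the two rates;
  -- the total variation of `k * A` is at most `k * π`.
  have hup : ∀ a ∈ Ioo 0 T, ∀ b ∈ Ioo 0 T, a ≤ b → |log (e b) - log (e a)| ≤ k * π := by
    intro a ha b hb hab
    have m1 : MonotoneOn (fun t ↦ -log (e t) - k * A t) (Ioo 0 T) := by
      refine monotoneOn_Ioo_of_hasDerivAt (f' := fun t ↦ -(de t / e t) - k * A' t)
        (fun t ht ↦ (hlog t ht).neg.sub ((hA' t ht).const_mul k)) fun t ht ↦ ?_
      have h1 := (abs_le.1 (hlogle t ht)).2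
      have h2 := mul_le_mul_of_nonneg_left (hA'le t ht) hk0
      have h3 : k * -(c * y t) = -(C * y t) := by rw [← hkc]; ring
      linarith
    have m2 : MonotoneOn (fun t ↦ log (e t) - k * A t) (Ioo 0 T) := by
      refine monotoneOn_Ioo_of_hasDerivAt (f' := fun t ↦ de t / e t - k * A' t)
        (fun t ht ↦ (hlog t ht).sub ((hA' t ht).const_mul k)) fun t ht ↦ ?_
      have h1 := (abs_le.1 (hlogle t ht)).1
      have h2 := mul_le_mul_of_nonneg_left (hA'le t ht) hk0
      have h3 : k * -(c * y t) = -(C * y t) := by rw [← hkc]; ring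
      linarith
    have h1 := m1 ha hb hab
    have h2 := m2 ha hb hab
    simp only at h1 h2
    have h3 : k * A a ≤ k * (π / 2) := mul_le_mul_of_nonneg_left (hAlt a).2.le hk0
    have h4 : k * -(π / 2) ≤ k * A b := mul_le_mul_of_nonneg_left (hAlt b).1.le hk0
    have h5 : k * (π / 2) - k * -(π / 2) = k * π := by ring
    rw [abs_le]
    constructor <;> linarith
  have hexp : ∀ a b : ℝ, 0 < a → 0 < b → log b - log a ≤ k * π → b ≤ a * exp (k * π) := by
    intro a b ha hb h
    rw [← log_le_log_iff hb (by positivity), log_mul ha.ne' (exp_pos _).ne', log_exp]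
    linarith
  -- The slope is not controlled at time `0`, where `y` may vanish, so the bounds involving `e 0`
  -- come from a one-sided limit.
  have hlim : Tendsto e (𝓝[>] 0) (𝓝 (e 0)) := hec.continuousAt.tendsto.mono_left nhdsWithin_le_nhds
  have hsmall : ∀ b ∈ Ioo 0 T, ∀ᶠ a in 𝓝[>] (0 : ℝ), a ∈ Ioo 0 T ∧ a ≤ b := by
    intro b hb
    filter_upwards [Ioo_mem_nhdsGT hb.1] with a ha
    exact ⟨⟨ha.1, ha.2.trans hb.2⟩, ha.2.le⟩
  have hfst : ∀ t ∈ Ioo 0 T, e t ≤ e 0 * exp (k * π) := by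
    intro b hb
    refine ge_of_tendsto (hlim.mul_const _) ?_
    filter_upwards [hsmall b hb] with a ha
    exact hexp _ _ (hepos a ha.1) (hepos b hb) (abs_le.1 (hup a ha.1 b hb ha.2)).2
  have hlow : ∀ t ∈ Ioo 0 T, e 0 ≤ e t * exp (k * π) := by
    intro b hb
    refine le_of_tendsto hlim ?_
    filter_upwards [hsmall b hb] with a ha
    exact hexp _ _ (hepos b hb) (hepos a ha.1)
      (by linarith [(abs_le.1 (hup a ha.1 b hb ha.2)).1])
  refine ⟨fun t ht ↦ ⟨hfst t ht, hlow t ht⟩, ?_, ?_⟩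
  · intro a ha b hb hab
    set c₀ := e 0 / (2 * D * exp (k * π)) with hc₀
    have hc₀pos : 0 < c₀ := by positivity
    -- The angle term contributes at least `(C + 1) * y`, which turns the lower bound `u² / 2 - C *
    -- y` into `u² / 2 + y`. This is at least `c₀` because the energy cannot decay. Since `u * y`
    -- and `A` are bounded, so is the time.
    have m : MonotoneOn (fun t ↦ u t * y t - (C + 1) / c * A t - c₀ * t) (Ioo 0 T) := by
      refine monotoneOn_Ioo_of_hasDerivAt
        (f' := fun t ↦ (du t * y t + u t * dy t) - (C + 1) / c * A' t - c₀ * 1) (fun t ht ↦ ?_)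
        fun t ht ↦ ?_
      · obtain ⟨hy, he⟩ := hgood t ht
        obtain ⟨h1, h2, -⟩ := hest t hy.le he
        exact ((h1.mul h2).sub ((hA' t ht).const_mul _)).sub ((hasDerivAt_id t).const_mul _)
      · obtain ⟨hy, he⟩ := hgood t ht
        obtain ⟨-, -, -, -, -, h6⟩ := hest t hy.le he
        have h1 := mul_le_mul_of_nonneg_left (hA'le t ht) (by positivity : 0 ≤ (C + 1) / c)
        have h2 : (C + 1) / c * -(c * y t) = -((C + 1) * y t) := by field_simp
        have h3 : c₀ ≤ (u t ^ 2 + y t) / 2 := by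
          rw [hc₀, div_le_iff₀ (by positivity)]
          have h4 := mul_le_mul_of_nonneg_right (hle t hy.le he) (exp_pos (k * π)).le
          have h5 := hlow t ht
          linarith
        linarith
    have h1 := m ha hb hab
    simp only at h1
    have hb1 : ∀ t ∈ Ioo 0 T, |u t * y t| ≤ 1 + ε := by
      intro t ht
      obtain ⟨hy, he⟩ := hgood t ht
      have := hge t hy.le
      rw [abs_le]
      constructor <;> nlinarith [sq_nonneg (u t + y t), sq_nonneg (u t - y t),
        sq_nonneg (y t ^ 2 - 1), sq_nonneg (u t), sq_nonneg (y t ^ 2)]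
    have h3 : (C + 1) / c * A a ≤ (C + 1) / c * (π / 2) :=
      mul_le_mul_of_nonneg_left (hAlt a).2.le (by positivity)
    have h4 : (C + 1) / c * -(π / 2) ≤ (C + 1) / c * A b :=
      mul_le_mul_of_nonneg_left (hAlt b).1.le (by positivity)
    have h5 : (C + 1) / c * (π / 2) - (C + 1) / c * -(π / 2) = (C + 1) / c * π := by ring
    have h6 := abs_le.1 (hb1 a ha)
    have h7 := abs_le.1 (hb1 b hb)
    rw [le_div_iff₀ hc₀pos]
    linarith
  · refine strictAntiOn_of_hasDerivWithinAt_neg (convex_Ioo 0 T) (f' := s')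
      (fun t ht ↦ (hs' t ht).continuousAt.continuousWithinAt) ?_ ?_
    · rw [interior_Ioo]; exact fun t ht ↦ (hs' t ht).hasDerivWithinAt
    · rwa [interior_Ioo]

/-- A trajectory that starts close to the singular point, in the open upper half-plane or on the
positive half-axis, returns to the axis on the negative half-axis. -/
theorem exists_half_turn {c C D ε : ℝ} (hc : 0 < c) (hC : 0 ≤ C) (hD : 0 < D)
    {u y e du dy de : ℝ → ℝ} (hyc : Continuous y) (hec : Continuous e)
    (hest : ∀ t, 0 ≤ y t → e t < ε → HasDerivAt u (du t) t ∧ HasDerivAt y (dy t) t ∧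
      HasDerivAt e (de t) t ∧ y t * du t - 2 * u t * dy t ≤ -c * (u t ^ 2 + y t ^ 4) ∧
      |de t| ≤ C * y t * e t ∧ u t ^ 2 / 2 - C * y t ≤ u t * dy t + y t * du t)
    (hge : ∀ t, 0 ≤ y t → u t ^ 2 + y t ^ 4 ≤ e t)
    (hle : ∀ t, 0 ≤ y t → e t < ε → e t ≤ D * (u t ^ 2 + y t))
    (h0 : 0 ≤ y 0) (h0' : y 0 = 0 → 0 < u 0) (hes : e 0 * exp (C / c * π) < ε) :
    ∃ t₁ > 0, y t₁ = 0 ∧ u t₁ < 0 ∧ (∀ t ∈ Ioo 0 t₁, 0 < y t) ∧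
      (∀ t ∈ Icc 0 t₁, e t ≤ e 0 * exp (C / c * π)) ∧
      StrictAntiOn (fun t ↦ u t / y t ^ 2) (Ioo 0 t₁) := by
  have he0 : 0 < e 0 := by
    have h1 := hge 0 h0
    rcases h0.eq_or_lt with h | h
    · have := h0' h.symm
      have : 0 < u 0 ^ 2 + y 0 ^ 4 := by positivity
      linarith
    · have : 0 < u 0 ^ 2 + y 0 ^ 4 := by positivity
      linarith
  have hM : 1 ≤ exp (C / c * π) := one_le_exp (by positivity)
  have he0M : e 0 ≤ e 0 * exp (C / c * π) := le_mul_of_one_le_right he0.le hM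
  have he0ε : e 0 < ε := by linarith
  have hε : 0 < ε := he0.trans he0ε
  have hstart : ∀ᶠ t in 𝓝[>] (0 : ℝ), 0 < y t ∧ e t < ε := by
    have h1 : ∀ᶠ t in 𝓝[>] (0 : ℝ), e t < ε :=
      (hec.continuousAt.eventually_lt continuousAt_const he0ε).filter_mono nhdsWithin_le_nhds
    have h2 : ∀ᶠ t in 𝓝[>] (0 : ℝ), 0 < y t := by
      rcases h0.eq_or_lt with h | h
      · obtain ⟨-, h2, -, -, -, h6⟩ := hest 0 h0 he0ε
        have hu := h0' h.symm
        have hdy : 0 < dy 0 := by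
          rw [← h] at h6
          have : 0 < u 0 * dy 0 := by nlinarith
          exact (pos_iff_pos_of_mul_pos this).1 hu
        filter_upwards [h2.eventually_lt_right hdy] with t ht
        linarith
      · exact (continuousAt_const.eventually_lt hyc.continuousAt h).filter_mono nhdsWithin_le_nhds
    exact h2.and h1
  obtain ⟨η, hη, hηgood⟩ := (mem_nhdsGT_iff_exists_Ioo_subset).1 hstart
  have hη : (0 : ℝ) < η := hη
  -- The cut-off `η / 2` excludes the start, where `y` may be zero; the infimum is then the first
  -- exit time.
  set Bad : Set ℝ := {t | η / 2 ≤ t ∧ (y t ≤ 0 ∨ ε ≤ e t)}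
  have hBad_closed : IsClosed Bad :=
    isClosed_Ici.inter ((isClosed_le hyc continuous_const).union (isClosed_le continuous_const hec))
  have hgoodT : ∀ T, (∀ t ∈ Bad, T ≤ t) → ∀ t ∈ Ioo 0 T, 0 < y t ∧ e t < ε := by
    intro T hT t ht
    by_cases h : t < η
    · exact hηgood ⟨ht.1, h⟩
    · by_contra hcon
      have : t ∈ Bad := ⟨by linarith, by
        by_contra! h'
        exact hcon ⟨h'.1, h'.2⟩⟩
      linarith [hT t this, ht.2]
  have hne : Bad.Nonempty := by
    by_contra hemp
    rw [not_nonempty_iff_eq_empty] at hemp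
    -- Without an exit, the interval from `1 / 4` to `B + 3 / 4` would be longer than the time bound
    -- `B`.
    set B := ((C + 1) / c * π + 2 * (1 + ε)) / (e 0 / (2 * D * exp (C / c * π)))
    have hB : 0 ≤ B := by positivity
    have h := (half_turn_bounds hc hC hD hec hest hge hle he0
      (hgoodT (B + 1) (by simp [hemp]))).2.1 (1 / 4) ⟨by norm_num, by linarith⟩ (B + 3 / 4)
      ⟨by linarith, by linarith⟩ (by linarith)
    change _ ≤ B at h
    linarith
  have hbdd : BddBelow Bad := ⟨η / 2, fun t ht ↦ ht.1⟩
  set t₁ := sInf Bad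
  have ht₁ : t₁ ∈ Bad := hBad_closed.csInf_mem hne hbdd
  have ht₁pos : 0 < t₁ := by linarith [ht₁.1]
  have hgood := hgoodT t₁ fun t ht ↦ csInf_le hbdd ht
  obtain ⟨hb1, -, hb3⟩ := half_turn_bounds hc hC hD hec hest hge hle he0 hgood
  have hlimit : ∀ {p : ℝ → Prop}, (∀ t ∈ Ioo 0 t₁, p t) → ∀ᶠ t in 𝓝[<] t₁, p t := fun h ↦ by
    filter_upwards [Ioo_mem_nhdsLT ht₁pos] with t ht using h t ht
  have het₁ : e t₁ ≤ e 0 * exp (C / c * π) :=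
    le_of_tendsto (hec.continuousAt.tendsto.mono_left nhdsWithin_le_nhds) (hlimit fun t ht ↦ (hb1 t ht).1)
  have hyt₁ : 0 ≤ y t₁ :=
    ge_of_tendsto (hyc.continuousAt.tendsto.mono_left nhdsWithin_le_nhds)
      (hlimit fun t ht ↦ (hgood t ht).1.le)
  have hy0 : y t₁ = 0 := le_antisymm (ht₁.2.resolve_right (by linarith)) hyt₁
  refine ⟨t₁, ht₁pos, hy0, ?_, fun t ht ↦ (hgood t ht).1, fun t ht ↦ ?_, hb3⟩
  -- The energy stays positive, so `u t₁ ≠ 0`. A positive value would make `y` increase through zero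
  -- at `t₁`, although `y` is positive just before.
  · have helow : 0 < e t₁ := by
      by_contra hcon
      have hz : e t₁ = 0 := by
        have := hge t₁ hyt₁
        have : 0 ≤ u t₁ ^ 2 + y t₁ ^ 4 := by positivity
        linarith
      have hlow : ∀ t ∈ Ioo 0 t₁, e 0 / exp (C / c * π) ≤ e t := by
        exact fun t ht ↦ (div_le_iff₀ (exp_pos _)).2 (hb1 t ht).2
      have := ge_of_tendsto (hec.continuousAt.tendsto.mono_left nhdsWithin_le_nhds) (hlimit hlow)
      have : 0 < e 0 / exp (C / c * π) := by positivity
      linarith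
    obtain ⟨-, h2, -, -, -, h6⟩ := hest t₁ hyt₁ (by linarith)
    have hu2 : 0 < u t₁ ^ 2 := by
      have := hle t₁ hyt₁ (by linarith)
      rw [hy0, add_zero] at this
      exact (mul_pos_iff_of_pos_left hD).1 (by linarith)
    by_contra! hu
    have hu' : 0 < u t₁ := hu.lt_of_ne fun h ↦ by simp [← h] at hu2
    have hdy : 0 < dy t₁ := by
      rw [hy0] at h6
      have : 0 < u t₁ * dy t₁ := by nlinarith
      exact (pos_iff_pos_of_mul_pos this).1 hu'
    obtain ⟨t, ht1, ht2⟩ :=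
      ((h2.eventually_lt_left hdy).and (hlimit fun t ht ↦ (hgood t ht).1)).exists
    linarith
  · rcases ht.1.eq_or_lt with h | h
    · rw [← h]; exact he0M
    · rcases ht.2.eq_or_lt with h' | h'
      · rw [h']; exact het₁
      · exact (hb1 t ⟨h, h'⟩).1

end HalfTurn

/-! ### Global flows, and uniqueness of Filippov solutions of a continuous system. -/

section Filippov

open Set Filter Topology Metric MeasureTheory NNReal

/-- A bounded Lipschitz vector field has global integral curves. -/
theorem exists_global_solution {E : Type*} [NormedAddCommGroup E] [NormedSpace ℝ E]
    [CompleteSpace E] {f : E → E} {K L : ℝ≥0} (hf : LipschitzWith K f) (hL : ∀ x, ‖f x‖ ≤ L)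
    (x : E) : ∃ γ : ℝ → E, γ 0 = x ∧ ∀ t, HasDerivAt γ (f (γ t)) t := by
  have key : ∀ n : ℕ, ∃ α : ℝ → E, α 0 = x ∧ ∀ t ∈ Icc (-(n + 1 : ℝ)) (n + 1),
      HasDerivWithinAt α (f (α t)) (Icc (-(n + 1 : ℝ)) (n + 1)) t := by
    intro n
    have h0 : (0 : ℝ) ∈ Icc (-(n + 1 : ℝ)) (n + 1) := ⟨by linarith [n.cast_nonneg (α := ℝ)],
      by positivity⟩
    have hP : IsPicardLindelof (fun _ ↦ f) (⟨0, h0⟩ : Icc (-(n + 1 : ℝ)) (n + 1)) x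
        (L * (n + 1)) 0 L K :=
      IsPicardLindelof.of_time_independent (fun y _ ↦ hL y) hf.lipschitzOnWith (by simp)
    exact hP.exists_eq_forall_mem_Icc_hasDerivWithinAt₀
  choose α hα0 hα using key
  have hmono : ∀ m n : ℕ, m ≤ n → EqOn (α m) (α n) (Icc (-(m + 1 : ℝ)) (m + 1)) := by
    intro m n hmn
    have hmn' : (m : ℝ) ≤ n := by exact_mod_cast hmn
    have hsub : Icc (-(m + 1 : ℝ)) (m + 1) ⊆ Icc (-(n + 1 : ℝ)) (n + 1) :=
      Icc_subset_Icc (by linarith) (by linarith)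
    have hd : ∀ t ∈ Ioo (-(m + 1 : ℝ)) (m + 1), ∀ k, m ≤ k → HasDerivAt (α k) (f (α k t)) t := by
      intro t ht k hk
      have hk' : (m : ℝ) ≤ k := by exact_mod_cast hk
      exact (hα k t ⟨by linarith [ht.1], by linarith [ht.2]⟩).hasDerivAt
        (Icc_mem_nhds (by linarith [ht.1]) (by linarith [ht.2]))
    exact ODE_solution_unique_of_mem_Icc (v := fun _ ↦ f) (s := fun _ ↦ univ) (K := K) (t₀ := 0)
      (fun _ _ ↦ hf.lipschitzOnWith)
      ⟨by linarith [m.cast_nonneg (α := ℝ)], by positivity⟩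
      (fun t ht ↦ (hα m t ht).continuousWithinAt) (fun t ht ↦ hd t ht m le_rfl)
      (fun _ _ ↦ trivial)
      (fun t ht ↦ ((hα n t (hsub ht)).continuousWithinAt).mono hsub)
      (fun t ht ↦ hd t ht n hmn) (fun _ _ ↦ trivial) (by rw [hα0, hα0])
  refine ⟨fun t ↦ α ⌈|t|⌉₊ t, by simp [hα0], fun t ↦ ?_⟩
  -- The extra unit makes a whole neighbourhood of `t` lie inside the domain of the single solution
  -- `α n`.
  set n := ⌈|t|⌉₊ + 1 with hn
  have htn : |t| < n := by
    have := Nat.le_ceil |t|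
    push_cast [hn]; linarith
  have heq : (fun t ↦ α ⌈|t|⌉₊ t) =ᶠ[𝓝 t] α n := by
    filter_upwards [(isOpen_lt continuous_abs continuous_const).mem_nhds htn] with s hs
    have hs' : |s| < n := hs
    have := Nat.le_ceil |s|
    exact hmono _ n (Nat.ceil_le.2 hs'.le) (abs_le.1 (by linarith))
  have hd : HasDerivAt (α n) (f (α n t)) t := by
    have := abs_lt.1 htn
    exact (hα n t ⟨by linarith, by linarith⟩).hasDerivAt
      (Icc_mem_nhds (by linarith) (by linarith))
  have h1 := heq.eq_of_nhds
  beta_reduce at h1 ⊢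
  rw [h1]
  exact hd.congr_of_eventuallyEq heq

theorem ContDiff.exists_lipschitzOnWith_of_isCompact {X : ℝ × ℝ → ℝ × ℝ} (hX : ContDiff ℝ 1 X)
    {s : Set (ℝ × ℝ)} (hs : IsCompact s) : ∃ K, LipschitzOnWith K X s :=
  (hX.locallyLipschitz.locallyLipschitzOn).exists_lipschitzOnWith_of_compact hs

/-- A `C¹` planar vector field agrees on a bounded set with a vector field which is bounded and
globally Lipschitz. -/
theorem exists_lipschitz_truncation {X : ℝ × ℝ → ℝ × ℝ} (hX : ContDiff ℝ 1 X) (R : ℝ) :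
    ∃ (Y : ℝ × ℝ → ℝ × ℝ) (K L : ℝ≥0), LipschitzWith K Y ∧ (∀ q, ‖Y q‖ ≤ L) ∧
      ∀ q : ℝ × ℝ, |q.1| ≤ R → |q.2| ≤ R → Y q = X q := by
  have hbox : IsCompact (Icc (-R) R ×ˢ Icc (-R) R : Set (ℝ × ℝ)) := isCompact_Icc.prod isCompact_Icc
  obtain ⟨K, hK⟩ := hX.exists_lipschitzOnWith_of_isCompact hbox
  obtain ⟨C, hC⟩ := hbox.exists_bound_of_continuousOn hX.continuous.continuousOn
  by_cases hR : 0 ≤ R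
  · set c : ℝ → ℝ := fun t ↦ max (-R) (min R t)
    have hc : LipschitzWith 1 c := (LipschitzWith.id.const_min R).const_max (-R)
    have hmem : ∀ t, c t ∈ Icc (-R) R := fun t ↦
      ⟨le_max_left _ _, max_le (by linarith) (min_le_left _ _)⟩
    have hP : LipschitzWith 1 (fun q : ℝ × ℝ ↦ (c q.1, c q.2)) := by
      have := (hc.comp LipschitzWith.prod_fst).prodMk (hc.comp LipschitzWith.prod_snd)
      simpa using this
    refine ⟨fun q ↦ X (c q.1, c q.2), K, Real.toNNReal C, ?_, fun q ↦ ?_, fun q h1 h2 ↦ ?_⟩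
    · rw [← lipschitzOnWith_univ]
      have := hK.comp (hP.lipschitzOnWith (s := univ)) (fun q _ ↦ ⟨hmem q.1, hmem q.2⟩)
      simpa [Function.comp_def] using this
    · exact (hC _ ⟨hmem _, hmem _⟩).trans (Real.le_coe_toNNReal C)
    · have : ∀ t, |t| ≤ R → c t = t := fun t ht ↦ by
        have := abs_le.1 ht
        simp [c, this.1, this.2]
      simp only
      rw [this _ h1, this _ h2]
  · refine ⟨fun _ ↦ 0, 0, 0, LipschitzWith.const _, by simp, fun q h1 _ ↦ ?_⟩
    exact absurd ((abs_nonneg _).trans h1) hR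

namespace SwitchingSystem

variable {S : SwitchingSystem} {X : ℝ × ℝ → ℝ × ℝ}

theorem isSolutionOn_univ (hX : Continuous X) (hv : ∀ q, S.velocities q = {X q})
    {γ : ℝ → ℝ × ℝ} (hγ : ∀ t, HasDerivAt γ (X (γ t)) t) : S.IsSolutionOn γ univ := by
  have hc : Continuous fun t ↦ X (γ t) :=
    hX.comp (continuous_iff_continuousAt.2 fun t ↦ (hγ t).continuousAt)
  refine ⟨fun t ↦ X (γ t), fun a _ b _ ↦ ⟨hc.intervalIntegrable _ _, ?_⟩, ?_⟩
  · rw [intervalIntegral.integral_eq_sub_of_hasDerivAt (fun t _ ↦ hγ t) (hc.intervalIntegrable _ _)]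
  · exact Eventually.of_forall fun t ↦ by rw [hv]; rfl

/-- If the Filippov velocities are given by a `C¹` vector field, then Filippov solutions are
determined by their initial value. -/
theorem IsSolutionOn.eqOn (hX : ContDiff ℝ 1 X) (hv : ∀ q, S.velocities q = {X q})
    {γ δ : ℝ → ℝ × ℝ} (hγ : ∀ t, HasDerivAt γ (X (γ t)) t) {J : Set ℝ} (hJ : J.OrdConnected)
    (h0 : 0 ∈ J) (hδ : S.IsSolutionOn δ J) (hδ0 : δ 0 = γ 0) : EqOn δ γ J := by
  obtain ⟨v, hv1, hv2⟩ := hδ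
  have hvX : ∀ᵐ t ∂(volume.restrict J), v t = X (δ t) := by
    filter_upwards [hv2] with t ht
    rw [hv] at ht
    exact ht
  intro t ht
  set a := min 0 t
  set b := max 0 t
  have hab : a ≤ b := min_le_max
  have haJ : a ∈ J := by rcases min_choice 0 t with h | h <;> simp only [a, h, h0, ht]
  have hbJ : b ∈ J := by rcases max_choice 0 t with h | h <;> simp only [b, h, h0, ht]
  have hIJ : Icc a b ⊆ J := hJ.out haJ hbJ
  have h0I : (0 : ℝ) ∈ Icc a b := ⟨min_le_left _ _, le_max_left _ _⟩
  have htI : t ∈ Icc a b := ⟨min_le_right _ _, le_max_right _ _⟩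
  have hδc : ContinuousOn δ (Icc a b) := by
    have h1 : ContinuousOn (fun s ↦ δ a + ∫ r in a..s, v r) (uIcc a b) :=
      continuousOn_const.add
        (intervalIntegral.continuousOn_primitive_interval' (hv1 a haJ b hbJ).1 left_mem_uIcc)
    rw [uIcc_of_le hab] at h1
    refine h1.congr fun s hs ↦ ?_
    have := (hv1 a haJ s (hIJ hs)).2
    simp only [← this]; abel
  -- A Filippov solution is only absolutely continuous. Extending it by constants gives a continuous
  -- integrand `X ∘ δ'`, whose primitive `D` is `C¹` and equals `δ` on `[a, b]`; so `δ` is a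
  -- classical solution there.
  set δ' : ℝ → ℝ × ℝ := IccExtend hab ((Icc a b).domRestrict δ)
  have hδ' : Continuous δ' := (continuousOn_iff_continuous_domRestrict.1 hδc).Icc_extend'
  have hδ'eq : ∀ s ∈ Icc a b, δ' s = δ s := fun s hs ↦ IccExtend_of_mem hab _ hs
  set D : ℝ → ℝ × ℝ := fun s ↦ δ 0 + ∫ r in (0 : ℝ)..s, X (δ' r)
  have hf : Continuous fun r ↦ X (δ' r) := hX.continuous.comp hδ'
  have hD : ∀ s, HasDerivAt D (X (δ' s)) s := fun s ↦
    (intervalIntegral.integral_hasDerivAt_right (hf.intervalIntegrable _ _)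
      hf.stronglyMeasurable.stronglyMeasurableAtFilter hf.continuousAt).const_add _
  have hDδ : ∀ s ∈ Icc a b, D s = δ s := by
    intro s hs
    have h1 : ∫ r in (0 : ℝ)..s, X (δ' r) = ∫ r in (0 : ℝ)..s, v r := by
      apply intervalIntegral.integral_congr_ae
      have hsub : uIoc 0 s ⊆ Icc a b := uIoc_subset_uIcc.trans (uIcc_subset_Icc h0I hs)
      have h2 := ae_imp_of_ae_restrict (ae_restrict_of_ae_restrict_of_subset hIJ hvX)
      filter_upwards [h2] with r hr hr'
      rw [hr (hsub hr'), hδ'eq r (hsub hr')]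
    simp only [D]
    rw [h1, ← (hv1 0 h0 s (hIJ hs)).2]; abel
  have hDd : ∀ s ∈ Icc a b, HasDerivAt D (X (D s)) s := fun s hs ↦ by
    rw [hDδ s hs, ← hδ'eq s hs]; exact hD s
  have hDc : Continuous D := continuous_iff_continuousAt.2 fun s ↦ (hD s).continuousAt
  have hγc : Continuous γ := continuous_iff_continuousAt.2 fun s ↦ (hγ s).continuousAt
  have hcpt : IsCompact (D '' Icc a b ∪ γ '' Icc a b) :=
    (isCompact_Icc.image hDc).union (isCompact_Icc.image hγc)
  obtain ⟨K, hK⟩ := hX.exists_lipschitzOnWith_of_isCompact hcpt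
  have hD0 : D 0 = γ 0 := by simp [D, hδ0]
  rw [← hDδ t htI]
  rcases le_total 0 t with h | h
  · have ha : a = 0 := min_eq_left h
    exact ODE_solution_unique_of_mem_Icc_right (v := fun _ ↦ X) (fun _ _ ↦ hK) hDc.continuousOn
      (fun s hs ↦ (hDd s (Ico_subset_Icc_self hs)).hasDerivWithinAt)
      (fun s hs ↦ Or.inl ⟨s, Ico_subset_Icc_self hs, rfl⟩) hγc.continuousOn
      (fun s _ ↦ (hγ s).hasDerivWithinAt)
      (fun s hs ↦ Or.inr ⟨s, Ico_subset_Icc_self hs, rfl⟩) (by rw [ha, hD0]) htI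
  · have ha : a = t := min_eq_right h
    have hb : b = 0 := max_eq_left h
    exact ODE_solution_unique_of_mem_Icc_left (v := fun _ ↦ X) (fun _ _ ↦ hK) hDc.continuousOn
      (fun s hs ↦ (hDd s (Ioc_subset_Icc_self hs)).hasDerivWithinAt)
      (fun s hs ↦ Or.inl ⟨s, Ioc_subset_Icc_self hs, rfl⟩) hγc.continuousOn
      (fun s _ ↦ (hγ s).hasDerivWithinAt)
      (fun s hs ↦ Or.inr ⟨s, Ioc_subset_Icc_self hs, rfl⟩) (by rw [hb, hD0]) htI

end SwitchingSystem

end Filippov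

/-! ### Weighted estimates for the nilpotent normal form. -/

section Nilpotent

open Set Filter Topology Real

/-- First component of a planar cubic field with a nilpotent singularity at the origin. -/
def nilFst (α p₁ p₂ p₃ p₄ u y : ℝ) : ℝ :=
  -α * y ^ 2 + p₁ * u * y ^ 2 + p₂ * u * y + p₃ * u ^ 2 * y + p₄ * y ^ 3

/-- Second component of a planar cubic field with a nilpotent singularity at the origin. -/
def nilSnd (q₁ q₂ q₃ q₄ q₅ q₆ q₇ u y : ℝ) : ℝ :=
  u + q₁ * u ^ 2 + q₂ * u ^ 3 + q₃ * u * y + q₄ * u ^ 2 * y + q₅ * y ^ 2 + q₆ * u * y ^ 2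
    + q₇ * y ^ 3

/-- Energy adapted to the nilpotent singularity of `(nilFst, nilSnd)`. -/
noncomputable def nilEnergy (α u y : ℝ) : ℝ := u ^ 2 + 2 / 3 * α * y ^ 3 + y ^ 4

theorem abs_const_mul_le (k : ℝ) {m B : ℝ} (h : |m| ≤ B) : |k * m| ≤ |k| * B := by
  rw [abs_mul]; exact mul_le_mul_of_nonneg_left h (abs_nonneg k)

theorem abs_mul_sq_le (u y : ℝ) : |u * y ^ 2| ≤ u ^ 2 + y ^ 4 := by
  rw [abs_le]
  constructor <;> nlinarith [sq_nonneg (u + y ^ 2), sq_nonneg (u - y ^ 2), sq_nonneg u,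
    sq_nonneg (y ^ 2)]

/-- Completing the square leaves `2 (u - m v / 4)² + Δ v² / 8` with `Δ = -(m² + 8 p)`. The value of
`c` makes `c ≤ 1` and `c (m² + 8) ≤ Δ`, which is what comparing the two squares requires. -/
theorem quadratic_form_pos {m p : ℝ} (h : m ^ 2 + 8 * p < 0) :
    ∃ c > 0, ∀ u v : ℝ, c * (u ^ 2 + v ^ 2) ≤ 2 * u ^ 2 - m * u * v - p * v ^ 2 := by
  set Δ := -(m ^ 2 + 8 * p)
  have hΔ : 0 < Δ := by simp only [Δ]; linarith
  set c := min 1 (Δ / (m ^ 2 + 8))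
  have hc1 : c ≤ 1 := min_le_left _ _
  have hc2 : c * (m ^ 2 + 8) ≤ Δ := by
    have : c ≤ Δ / (m ^ 2 + 8) := min_le_right _ _
    rwa [le_div_iff₀ (by positivity)] at this
  refine ⟨c, lt_min one_pos (by positivity), fun u v ↦ ?_⟩
  have h1 : 2 * u ^ 2 - m * u * v - p * v ^ 2 = 2 * (u - m * v / 4) ^ 2 + Δ / 8 * v ^ 2 := by
    simp only [Δ]; ring
  have h2 : u ^ 2 ≤ 2 * (u - m * v / 4) ^ 2 + m ^ 2 * v ^ 2 / 8 := by
    nlinarith [sq_nonneg (u - m * v / 2)]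
  have hc0 : 0 < c := lt_min one_pos (by positivity)
  have h3 := mul_le_mul_of_nonneg_left h2 hc0.le
  have h4 := mul_le_mul_of_nonneg_right hc2 (sq_nonneg v)
  have h5 := mul_le_mul_of_nonneg_right hc1 (sq_nonneg (u - m * v / 4))
  rw [h1]
  nlinarith

variable {α p₁ p₂ p₃ p₄ q₁ q₂ q₃ q₄ q₅ q₆ q₇ : ℝ}

/-- The terms subtracted are those of weighted degree at most 4; all others have a factor `u²` or `u
y²` and a further factor bounded by `r`. The value `s = 2` gives rotation, and `s = -2` excludes
zeros with `y < 0`. -/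
theorem nil_rotation_remainder {r u y : ℝ} (hr1 : r ≤ 1) (hu : |u| ≤ r) (hy : |y| ≤ r) (s : ℝ) :
    |(y * nilFst α p₁ p₂ p₃ p₄ u y - s * u * nilSnd q₁ q₂ q₃ q₄ q₅ q₆ q₇ u y) -
      (-s * u ^ 2 + (p₂ - s * q₅) * (u * y ^ 2) + p₄ * y ^ 4 - α * y ^ 3)| ≤
    (|p₁| + |p₃| + |s * q₁| + |s * q₂| + |s * q₃| + |s * q₄| + |s * q₆| + |s * q₇|) *
      (r * (u ^ 2 + y ^ 4)) := by
  have hr0 : 0 ≤ r := (abs_nonneg _).trans hu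
  set N := u ^ 2 + y ^ 4 with hN
  have hN0 : 0 ≤ N := by positivity
  have hu2 : |u ^ 2| ≤ N := by rw [abs_of_nonneg (by positivity), hN]; nlinarith [sq_nonneg (y ^ 2)]
  have huy2 : |u * y ^ 2| ≤ N := abs_mul_sq_le u y
  have hm : ∀ a b, |a| ≤ N → |b| ≤ r → |a * b| ≤ r * N := fun a b ha hb ↦ by
    rw [abs_mul, mul_comm]; gcongr
  have hsm : ∀ b, |b| ≤ r → |b * b| ≤ r := fun b hb ↦ by
    rw [abs_mul]; nlinarith [abs_nonneg b]
  have huy : |u * y| ≤ r := by rw [abs_mul]; nlinarith [abs_nonneg u, abs_nonneg y]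
  have m1 := abs_le.1 (abs_const_mul_le p₁ (hm _ _ huy2 hy))
  have m2 := abs_le.1 (abs_const_mul_le p₃ (hm _ _ hu2 (hsm y hy)))
  have m3 := abs_le.1 (abs_const_mul_le (s * q₁) (hm _ _ hu2 hu))
  have m4 := abs_le.1 (abs_const_mul_le (s * q₂) (hm _ _ hu2 (hsm u hu)))
  have m5 := abs_le.1 (abs_const_mul_le (s * q₃) (hm _ _ hu2 hy))
  have m6 := abs_le.1 (abs_const_mul_le (s * q₄) (hm _ _ hu2 huy))
  have m7 := abs_le.1 (abs_const_mul_le (s * q₆) (hm _ _ hu2 (hsm y hy)))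
  have m8 := abs_le.1 (abs_const_mul_le (s * q₇) (hm _ _ huy2 hy))
  have key : (y * nilFst α p₁ p₂ p₃ p₄ u y - s * u * nilSnd q₁ q₂ q₃ q₄ q₅ q₆ q₇ u y) -
      (-s * u ^ 2 + (p₂ - s * q₅) * (u * y ^ 2) + p₄ * y ^ 4 - α * y ^ 3) =
      p₁ * (u * y ^ 2 * y) + p₃ * (u ^ 2 * (y * y)) - s * q₁ * (u ^ 2 * u)
      - s * q₂ * (u ^ 2 * (u * u)) - s * q₃ * (u ^ 2 * y) - s * q₄ * (u ^ 2 * (u * y))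
      - s * q₆ * (u ^ 2 * (y * y)) - s * q₇ * (u * y ^ 2 * y) := by
    simp only [nilFst, nilSnd]; ring
  rw [key, abs_le]
  constructor <;> linarith

/-- Near a monodromic nilpotent singularity trajectories turn with respect to the parabolas
`u = s * y ^ 2`. -/
theorem nil_rotation (hα : 0 ≤ α) (h : 0 < α ∨ (p₂ - 2 * q₅) ^ 2 + 8 * p₄ < 0) :
    ∃ c > 0, ∃ r > 0, r ≤ 1 ∧ ∀ u y, |u| ≤ r → |y| ≤ r → (0 ≤ y ∨ α = 0) →
      y * nilFst α p₁ p₂ p₃ p₄ u y - 2 * u * nilSnd q₁ q₂ q₃ q₄ q₅ q₆ q₇ u y ≤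
        -c * (u ^ 2 + y ^ 4) := by
  obtain ⟨c, hc, r₀, hr₀, hmain⟩ : ∃ c > 0, ∃ r₀ > 0, ∀ u y : ℝ, |y| ≤ r₀ → (0 ≤ y ∨ α = 0) →
      2 * c * (u ^ 2 + y ^ 4) ≤
        2 * u ^ 2 - (p₂ - 2 * q₅) * (u * y ^ 2) - p₄ * y ^ 4 + α * y ^ 3 := by
    rcases h with h | h
    -- For `α > 0` the term `α * y ^ 3` has lower weight than the quadratic form. On `α / (m ^ 2 +
    -- |p₄| + 1)` it absorbs all multiples of `y ^ 4`, so no discriminant condition is needed.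
    · set m := p₂ - 2 * q₅
      refine ⟨1 / 2, by norm_num, α / (m ^ 2 + |p₄| + 1), by positivity, fun u y hy hs ↦ ?_⟩
      have hy0 : 0 ≤ y := hs.resolve_right h.ne'
      rw [abs_of_nonneg hy0, le_div_iff₀ (by positivity)] at hy
      have h1 := mul_le_mul_of_nonneg_right hy (by positivity : 0 ≤ y ^ 3)
      have h2 := mul_le_mul_of_nonneg_right (le_abs_self p₄) (by positivity : 0 ≤ y ^ 4)
      have h3 : 0 ≤ (u - m * y ^ 2 / 2) ^ 2 := sq_nonneg _
      nlinarith [mul_nonneg (sq_nonneg m) (by positivity : 0 ≤ y ^ 4)]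
    · obtain ⟨c, hc, hq⟩ := quadratic_form_pos h
      refine ⟨c / 2, by positivity, 1, one_pos, fun u y _ hs ↦ ?_⟩
      have h1 := hq u (y ^ 2)
      have h2 : 0 ≤ α * y ^ 3 := by
        rcases hs with hs | hs
        · positivity
        · simp [hs]
      nlinarith
  set K := |p₁| + |p₃| + |2 * q₁| + |2 * q₂| + |2 * q₃| + |2 * q₄| + |2 * q₆| + |2 * q₇|
  have hK : 0 ≤ K := by positivity
  -- The main part supplies `2 * c`; this radius lets the remainder consume at most `c` of it.
  set r := min (min 1 r₀) (c / (K + 1))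
  have hr : 0 < r := by positivity
  have hr1 : r ≤ 1 := (min_le_left _ _).trans (min_le_left _ _)
  have hrr₀ : r ≤ r₀ := (min_le_left _ _).trans (min_le_right _ _)
  have hrc : K * r ≤ c := by
    have h1 : r ≤ c / (K + 1) := min_le_right _ _
    rw [le_div_iff₀ (by positivity)] at h1
    nlinarith
  refine ⟨c, hc, r, hr, hr1, fun u y hu hy hs ↦ ?_⟩
  have h1 := (abs_le.1 (nil_rotation_remainder (α := α) (p₁ := p₁) (p₂ := p₂) (p₃ := p₃)
    (p₄ := p₄) (q₁ := q₁) (q₂ := q₂) (q₃ := q₃) (q₄ := q₄) (q₅ := q₅) (q₆ := q₆) (q₇ := q₇)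
    hr1 hu hy 2)).2
  have h2 := hmain u y (hy.trans hrr₀) hs
  have h3 := mul_le_mul_of_nonneg_right hrc (by positivity : 0 ≤ u ^ 2 + y ^ 4)
  have h4 : K * (r * (u ^ 2 + y ^ 4)) = K * r * (u ^ 2 + y ^ 4) := by ring
  rw [h4] at h1
  linarith

theorem nilEnergy_ge (hα : 0 ≤ α) {u y : ℝ} (hy : 0 ≤ y) :
    u ^ 2 + y ^ 4 ≤ nilEnergy α u y := by
  have : 0 ≤ 2 / 3 * α * y ^ 3 := by positivity
  simp only [nilEnergy]; linarith

/-- The leading terms `2u · (-α y²)` and `2α y² · u` cancel, and everything else is `y` times a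
monomial dominated by the energy. The summand `y⁴` of the energy keeps this true when `α = 0`. -/
theorem nilEnergy_deriv_bound (hα : 0 ≤ α) :
    ∃ C ≥ 0, ∀ u y : ℝ, |u| ≤ 1 → |y| ≤ 1 → 0 ≤ y →
      |2 * u * nilFst α p₁ p₂ p₃ p₄ u y +
        (2 * α * y ^ 2 + 4 * y ^ 3) * nilSnd q₁ q₂ q₃ q₄ q₅ q₆ q₇ u y| ≤
        C * y * nilEnergy α u y := by
  obtain ⟨K, hK⟩ : ∃ K, K = 2 * (|p₁| + |p₂| + |p₃| + |p₄|) +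
    2 * α * (|q₁| + |q₂| + |q₃| + |q₄| + |q₆| + |q₇|) + 3 * |q₅| +
    4 * (1 + |q₁| + |q₂| + |q₃| + |q₄| + |q₅| + |q₆| + |q₇|) := ⟨_, rfl⟩
  refine ⟨K, by rw [hK]; positivity, fun u y hu hy1 hy ↦ ?_⟩
  have hge := nilEnergy_ge hα (u := u) hy
  have hαy : α * y ^ 3 ≤ 3 / 2 * nilEnergy α u y := by
    simp only [nilEnergy]
    nlinarith [sq_nonneg u, sq_nonneg (y ^ 2)]
  set E := nilEnergy α u y
  have hu2 : |u ^ 2| ≤ E := by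
    rw [abs_of_nonneg (by positivity)]; nlinarith [sq_nonneg (y ^ 2)]
  have hy4 : |y ^ 4| ≤ E := by
    rw [abs_of_nonneg (by positivity)]; nlinarith [sq_nonneg u]
  have huy2 : |u * y ^ 2| ≤ E := (abs_mul_sq_le u y).trans hge
  have hE : 0 ≤ E := (abs_nonneg _).trans hu2
  have hm : ∀ {a b}, |a| ≤ E → |b| ≤ 1 → |a * b| ≤ E := fun {a b} ha hb ↦ by
    rw [abs_mul]; nlinarith [abs_nonneg a, abs_nonneg b]
  have hone : ∀ {a b : ℝ}, |a| ≤ 1 → |b| ≤ 1 → |a * b| ≤ 1 := fun {a b} ha hb ↦ by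
    rw [abs_mul]; exact mul_le_one₀ ha (abs_nonneg b) hb
  have ha : |α| = α := abs_of_nonneg hα
  have hαy' : |α * y ^ 3| ≤ 3 / 2 * E := by rwa [abs_of_nonneg (by positivity)]
  have huu := hone hu hu
  have huy := hone hu hy1
  have hyy := hone hy1 hy1
  have a1 := abs_const_mul_le (2 * p₁) (hm hu2 hy1)
  have a2 := abs_const_mul_le (2 * p₂) hu2
  have a3 := abs_const_mul_le (2 * p₃) (hm hu2 hu)
  have a4 := abs_const_mul_le (2 * p₄) huy2
  have b1 := abs_const_mul_le (2 * α * q₁) (hm hu2 hy1)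
  have b2 := abs_const_mul_le (2 * α * q₂) (hm hu2 huy)
  have b3 := abs_const_mul_le (2 * α * q₃) huy2
  have b4 := abs_const_mul_le (2 * α * q₄) (hm hu2 hyy)
  have b5 := abs_const_mul_le (2 * q₅) hαy'
  have b6 := abs_const_mul_le (2 * α * q₆) (hm huy2 hy1)
  have b7 := abs_const_mul_le (2 * α * q₇) hy4
  have c0 := abs_const_mul_le 4 huy2
  have c1 := abs_const_mul_le (4 * q₁) (hm hu2 hyy)
  have c2 := abs_const_mul_le (4 * q₂) (hm hu2 (hone huy hy1))
  have c3 := abs_const_mul_le (4 * q₃) (hm huy2 hy1)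
  have c4 := abs_const_mul_le (4 * q₄) (hm huy2 huy)
  have c5 := abs_const_mul_le (4 * q₅) hy4
  have c6 := abs_const_mul_le (4 * q₆) (hm hy4 hu)
  have c7 := abs_const_mul_le (4 * q₇) (hm hy4 hy1)
  simp only [abs_mul _ p₁, abs_mul _ p₂, abs_mul _ p₃, abs_mul _ p₄, abs_mul _ q₁, abs_mul _ q₂,
    abs_mul _ q₃, abs_mul _ q₄, abs_mul _ q₅, abs_mul _ q₆, abs_mul _ q₇, abs_mul 2 α, ha,
    Nat.abs_ofNat] at a1 a2 a3 a4 b1 b2 b3 b4 b5 b6 b7 c0 c1 c2 c3 c4 c5 c6 c7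
  have key : 2 * u * nilFst α p₁ p₂ p₃ p₄ u y +
        (2 * α * y ^ 2 + 4 * y ^ 3) * nilSnd q₁ q₂ q₃ q₄ q₅ q₆ q₇ u y = y * (
      2 * p₁ * (u ^ 2 * y) + 2 * p₂ * u ^ 2 + 2 * p₃ * (u ^ 2 * u) + 2 * p₄ * (u * y ^ 2) +
      2 * α * q₁ * (u ^ 2 * y) + 2 * α * q₂ * (u ^ 2 * (u * y)) + 2 * α * q₃ * (u * y ^ 2) +
      2 * α * q₄ * (u ^ 2 * (y * y)) + 2 * q₅ * (α * y ^ 3) + 2 * α * q₆ * (u * y ^ 2 * y) +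
      2 * α * q₇ * y ^ 4 + 4 * (u * y ^ 2) + 4 * q₁ * (u ^ 2 * (y * y)) +
      4 * q₂ * (u ^ 2 * (u * y * y)) + 4 * q₃ * (u * y ^ 2 * y) + 4 * q₄ * (u * y ^ 2 * (u * y)) +
      4 * q₅ * y ^ 4 + 4 * q₆ * (y ^ 4 * u) + 4 * q₇ * (y ^ 4 * y)) := by
    simp only [nilFst, nilSnd]; ring
  rw [key, abs_mul, abs_of_nonneg hy]
  refine (mul_le_mul_of_nonneg_left (?_ : _ ≤ K * E) hy).trans_eq (by ring)
  rw [hK]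
  rw [abs_le] at *
  constructor <;> linarith

/-- This is the derivative of `u y`. Its pure powers of `u` beyond `u²` are absorbed by half of `u²`
for small `r`; every remaining term contains `y`. -/
theorem nil_product_deriv_bound :
    ∃ C ≥ 0, ∃ r > 0, r ≤ 1 ∧ ∀ u y : ℝ, |u| ≤ r → |y| ≤ r → 0 ≤ y →
      u ^ 2 / 2 - C * y ≤
        u * nilSnd q₁ q₂ q₃ q₄ q₅ q₆ q₇ u y + y * nilFst α p₁ p₂ p₃ p₄ u y := by
  set r := 1 / (2 * (|q₁| + |q₂| + 1)) with hr
  have hr0 : 0 < r := by positivity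
  have hr2 : r * (|q₁| + |q₂| + 1) = 1 / 2 := by rw [hr]; field_simp
  have hr1 : r ≤ 1 := by nlinarith [abs_nonneg q₁, abs_nonneg q₂]
  refine ⟨|q₃| + |q₄| + |q₅| + |q₆| + |q₇| + |α| + |p₁| + |p₂| + |p₃| + |p₄|, by positivity, r,
    hr0, hr1, fun u y hu hy1 hy ↦ ?_⟩
  have hone : ∀ {a b : ℝ}, |a| ≤ 1 → |b| ≤ 1 → |a * b| ≤ 1 := fun {a b} ha hb ↦ by
    rw [abs_mul]; exact mul_le_one₀ ha (abs_nonneg b) hb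
  have hu1 : |u| ≤ 1 := hu.trans hr1
  have hy1 : |y| ≤ 1 := hy1.trans hr1
  have hyc : |1 * y| ≤ y := by rw [one_mul, abs_of_nonneg hy]
  have hm : ∀ {a}, |a| ≤ 1 → |a * y| ≤ y := fun {a} ha ↦ by
    rw [abs_mul, abs_of_nonneg hy]; nlinarith
  have huu := hone hu1 hu1
  have huy := hone hu1 hy1
  have hyy := hone hy1 hy1
  have hu3 : |u ^ 2 * u| ≤ u ^ 2 * r := by
    rw [abs_mul, abs_of_nonneg (sq_nonneg u)]; gcongr
  have hu4 : |u ^ 2 * (u * u)| ≤ u ^ 2 * r := by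
    rw [abs_mul, abs_of_nonneg (sq_nonneg u), abs_mul]
    have : |u| * |u| ≤ r := by nlinarith [abs_nonneg u]
    gcongr
  have a1 := (abs_le.1 (abs_const_mul_le q₁ hu3)).1
  have a2 := (abs_le.1 (abs_const_mul_le q₂ hu4)).1
  have a3 := (abs_le.1 (abs_const_mul_le q₃ (hm huu))).1
  have a4 := (abs_le.1 (abs_const_mul_le q₄ (hm (hone huu hu1)))).1
  have a5 := (abs_le.1 (abs_const_mul_le q₅ (hm huy))).1
  have a6 := (abs_le.1 (abs_const_mul_le q₆ (hm (hone huu hy1)))).1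
  have a7 := (abs_le.1 (abs_const_mul_le q₇ (hm (hone huy hy1)))).1
  have b0 := (abs_le.1 (abs_const_mul_le α (hm hyy))).2
  have b1 := (abs_le.1 (abs_const_mul_le p₁ (hm (hone huy hy1)))).1
  have b2 := (abs_le.1 (abs_const_mul_le p₂ (hm huy))).1
  have b3 := (abs_le.1 (abs_const_mul_le p₃ (hm (hone huu hy1)))).1
  have b4 := (abs_le.1 (abs_const_mul_le p₄ (hm (hone hyy hy1)))).1
  have hq : |q₁| * (u ^ 2 * r) + |q₂| * (u ^ 2 * r) ≤ u ^ 2 / 2 := by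
    have : |q₁| * (u ^ 2 * r) + |q₂| * (u ^ 2 * r) + r * u ^ 2 =
      r * (|q₁| + |q₂| + 1) * u ^ 2 := by ring
    rw [hr2] at this
    nlinarith [mul_nonneg hr0.le (sq_nonneg u)]
  have key : u * nilSnd q₁ q₂ q₃ q₄ q₅ q₆ q₇ u y + y * nilFst α p₁ p₂ p₃ p₄ u y =
      u ^ 2 + q₁ * (u ^ 2 * u) + q₂ * (u ^ 2 * (u * u)) + q₃ * (u * u * y) + q₄ * (u * u * u * y) +
      q₅ * (u * y * y) + q₆ * (u * u * y * y) + q₇ * (u * y * y * y) - α * (y * y * y) +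
      p₁ * (u * y * y * y) + p₂ * (u * y * y) + p₃ * (u * u * y * y) + p₄ * (y * y * y * y) := by
    simp only [nilFst, nilSnd]; ring
  rw [key]
  linarith

theorem nilEnergy_le (hα : 0 ≤ α) {u y : ℝ} (hy : 0 ≤ y) (hy1 : y ≤ 1) :
    nilEnergy α u y ≤ (1 + α) * (u ^ 2 + y) := by
  have h3 : y ^ 3 ≤ y := by simpa using pow_le_pow_of_le_one hy hy1 (by norm_num : 1 ≤ 3)
  have h4 : y ^ 4 ≤ y := by simpa using pow_le_pow_of_le_one hy hy1 (by norm_num : 1 ≤ 4)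
  simp only [nilEnergy]
  nlinarith [mul_nonneg hα (sq_nonneg u), mul_le_mul_of_nonneg_left h3 hα, mul_nonneg hα hy]

theorem abs_le_of_nilEnergy_lt (hα : 0 ≤ α) {u y r : ℝ} (hr : 0 < r) (hr1 : r ≤ 1) (hy : 0 ≤ y)
    (h : nilEnergy α u y < r ^ 4) : |u| ≤ r ∧ |y| ≤ r := by
  have h1 := nilEnergy_ge hα (u := u) hy
  have h2 : r ^ 4 ≤ r ^ 2 := pow_le_pow_of_le_one hr.le hr1 (by norm_num)
  constructor
  · refine abs_le_of_sq_le_sq ?_ hr.le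
    nlinarith [sq_nonneg (y ^ 2)]
  · rw [abs_of_nonneg hy]
    refine le_of_pow_le_pow_left₀ (n := 4) (by norm_num) hr.le ?_
    nlinarith [sq_nonneg u]

/-- Half-turn property of trajectories near a monodromic nilpotent singularity. -/
theorem nil_exists_half_turn (hα : 0 ≤ α) (h : 0 < α ∨ (p₂ - 2 * q₅) ^ 2 + 8 * p₄ < 0) {R : ℝ}
    (hR : 0 < R) :
    ∃ ε > 0, ∃ M ≥ 1, ∀ u y : ℝ → ℝ, Continuous u → Continuous y →
      (∀ t, 0 ≤ y t → |u t| ≤ R → |y t| ≤ R →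
        HasDerivAt u (nilFst α p₁ p₂ p₃ p₄ (u t) (y t)) t ∧
        HasDerivAt y (nilSnd q₁ q₂ q₃ q₄ q₅ q₆ q₇ (u t) (y t)) t) →
      0 ≤ y 0 → (y 0 = 0 → 0 < u 0) → nilEnergy α (u 0) (y 0) * M < ε →
      ∃ t₁ > 0, y t₁ = 0 ∧ u t₁ < 0 ∧ (∀ t ∈ Ioo 0 t₁, 0 < y t) ∧
        (∀ t ∈ Icc 0 t₁, nilEnergy α (u t) (y t) ≤ nilEnergy α (u 0) (y 0) * M) ∧
        StrictAntiOn (fun t ↦ u t / y t ^ 2) (Ioo 0 t₁) := by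
  obtain ⟨c, hc, r₁, hr₁, -, hrot⟩ := nil_rotation (p₁ := p₁) (p₃ := p₃) (q₁ := q₁) (q₂ := q₂)
    (q₃ := q₃) (q₄ := q₄) (q₆ := q₆) (q₇ := q₇) hα h
  obtain ⟨C₁, hC₁, henergy⟩ := nilEnergy_deriv_bound (p₁ := p₁) (p₂ := p₂) (p₃ := p₃) (p₄ := p₄)
    (q₁ := q₁) (q₂ := q₂) (q₃ := q₃) (q₄ := q₄) (q₅ := q₅) (q₆ := q₆) (q₇ := q₇) hα
  obtain ⟨C₂, hC₂, r₂, hr₂, hr₂1, hprod⟩ := nil_product_deriv_bound (α := α) (p₁ := p₁) (p₂ := p₂)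
    (p₃ := p₃) (p₄ := p₄) (q₁ := q₁) (q₂ := q₂) (q₃ := q₃) (q₄ := q₄) (q₅ := q₅) (q₆ := q₆)
    (q₇ := q₇)
  set C := max C₁ C₂
  set r := min R (min r₁ r₂)
  have hr : 0 < r := by positivity
  have hrR : r ≤ R := min_le_left _ _
  have hrr₁ : r ≤ r₁ := (min_le_right _ _).trans (min_le_left _ _)
  have hrr₂ : r ≤ r₂ := (min_le_right _ _).trans (min_le_right _ _)
  have hr1 : r ≤ 1 := hrr₂.trans hr₂1
  -- Energy below `r ^ 4` confines the orbit to the box of radius `r`, where all the estimates hold.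
  refine ⟨r ^ 4, by positivity, exp (C / c * π), one_le_exp (by positivity), ?_⟩
  intro u y hu hy hder h0 h0' hes
  have hbox : ∀ t, 0 ≤ y t → nilEnergy α (u t) (y t) < r ^ 4 → |u t| ≤ r ∧ |y t| ≤ r :=
    fun t ht hlt ↦ abs_le_of_nilEnergy_lt hα hr hr1 ht hlt
  refine exists_half_turn (D := 1 + α) (ε := r ^ 4) hc (le_max_of_le_left hC₁) (by positivity)
    (e := fun t ↦ nilEnergy α (u t) (y t))
    (du := fun t ↦ nilFst α p₁ p₂ p₃ p₄ (u t) (y t))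
    (dy := fun t ↦ nilSnd q₁ q₂ q₃ q₄ q₅ q₆ q₇ (u t) (y t))
    (de := fun t ↦ 2 * u t * nilFst α p₁ p₂ p₃ p₄ (u t) (y t) +
        (2 * α * y t ^ 2 + 4 * y t ^ 3) * nilSnd q₁ q₂ q₃ q₄ q₅ q₆ q₇ (u t) (y t))
    hy (by simp only [nilEnergy]; fun_prop) ?_ ?_ ?_ h0 h0' hes
  · intro t ht hlt
    obtain ⟨hut, hyt⟩ := hbox t ht hlt
    obtain ⟨hdu, hdy⟩ := hder t ht (hut.trans hrR) (hyt.trans hrR)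
    refine ⟨hdu, hdy, ?_, hrot _ _ (hut.trans hrr₁) (hyt.trans hrr₁) (Or.inl ht), ?_, ?_⟩
    · simp only [nilEnergy]
      have h1 := (hdu.fun_pow 2).add ((hdy.fun_pow 3).const_mul (2 / 3 * α)) |>.add (hdy.fun_pow 4)
      refine h1.congr_deriv ?_
      norm_num
      ring
    · refine (henergy _ _ (hut.trans hr1) (hyt.trans hr1) ht).trans ?_
      have := nilEnergy_ge hα (u := u t) ht
      have h0 : 0 ≤ nilEnergy α (u t) (y t) := le_trans (by positivity) this
      gcongr
      exact le_max_left _ _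
    · refine le_trans ?_ (hprod _ _ (hut.trans hrr₂) (hyt.trans hrr₂) ht)
      have : C₂ * y t ≤ C * y t := by gcongr; exact le_max_right _ _
      linarith
  · exact fun t ht ↦ nilEnergy_ge hα ht
  · intro t ht hlt
    exact nilEnergy_le hα ht ((le_abs_self _).trans ((hbox t ht hlt).2.trans hr1))

end Nilpotent

/-! ### Turning arcs, weighted dilations and surrounding. -/

section TurningArc

open Set Filter Topology Bornology

/-- An arc in the closed upper half-plane from the positive to the negative half-axis along which
the weighted slope `u / y ^ 2` decreases. -/
structure IsTurningArc (u y : ℝ → ℝ) (a b : ℝ) : Prop where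
  lt : a < b
  continuous_u : Continuous u
  continuous_y : Continuous y
  y_left : y a = 0
  y_right : y b = 0
  u_left : 0 < u a
  u_right : u b < 0
  y_pos : ∀ t ∈ Ioo a b, 0 < y t
  anti : StrictAntiOn (fun t ↦ u t / y t ^ 2) (Ioo a b)

namespace IsTurningArc

variable {u y : ℝ → ℝ} {a b : ℝ}

/-- The half-parabola through `(v, z)` is an orbit of the dilations. Its defining function `w`
changes sign between the ends of the arc, so the arc meets it. -/
theorem exists_dilation (h : IsTurningArc u y a b) {v z : ℝ} (hz : 0 < z) :
    ∃ t ∈ Ioo a b, ∃ l > 0, v = l ^ 2 * u t ∧ z = l * y t := by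
  set w : ℝ → ℝ := fun t ↦ u t - v / z ^ 2 * y t ^ 2
  have hw : Continuous w :=
    h.continuous_u.sub (continuous_const.mul (h.continuous_y.pow 2))
  have hwa : 0 < w a := by simp [w, h.y_left, h.u_left]
  have hwb : w b < 0 := by simp [w, h.y_right, h.u_right]
  obtain ⟨t, ht, hwt⟩ := intermediate_value_Icc' h.lt.le hw.continuousOn ⟨hwb.le, hwa.le⟩
  have ht' : t ∈ Ioo a b := by
    refine ⟨ht.1.lt_of_ne ?_, ht.2.lt_of_ne ?_⟩
    · rintro rfl; exact hwa.ne' hwt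
    · rintro rfl; exact hwb.ne hwt
  have hy := h.y_pos t ht'
  refine ⟨t, ht', z / y t, by positivity, ?_, by field_simp⟩
  have : u t = v / z ^ 2 * y t ^ 2 := by simp only [w] at hwt; linarith
  rw [this]
  field_simp

/-- Dilations preserve `u / y²`, which is injective along the arc; hence the arc meets each dilation
orbit once. -/
theorem dilation_eq_one (h : IsTurningArc u y a b) {s t l : ℝ} (hs : s ∈ Ioo a b)
    (ht : t ∈ Ioo a b) (hl : 0 < l) (hu : u t = l ^ 2 * u s) (hy : y t = l * y s) : l = 1 := by
  have hys := h.y_pos s hs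
  have hst : s = t := by
    apply h.anti.injOn hs ht
    simp only
    rw [hu, hy]
    field_simp
  rw [← hst] at hy
  exact (mul_right_cancel₀ hys.ne' (by linarith)).symm

end IsTurningArc

/-- A closed orbit consisting of an upper and a lower turning arc surrounds the point `(1, 0)`. -/
theorem isBounded_connectedComponentIn_of_turningArcs {γ : ℝ → ℝ × ℝ} (hγ : Continuous γ)
    {t₁ T : ℝ} (hper : Function.Periodic γ T)
    (hup : IsTurningArc (fun t ↦ (γ t).1 - 1) (fun t ↦ (γ t).2) 0 t₁)
    (hlo : IsTurningArc (fun t ↦ -((γ t).1 - 1)) (fun t ↦ -(γ t).2) t₁ T) :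
    ((1, 0) : ℝ × ℝ) ∉ range γ ∧
      IsBounded (connectedComponentIn (range γ)ᶜ ((1, 0) : ℝ × ℝ)) := by
  have hT : 0 < T := hup.lt.trans hlo.lt
  have hrange : range γ = γ '' Icc 0 T := by
    have := hper.image_Icc hT 0
    rw [zero_add] at this
    exact this.symm
  have hcpt : IsCompact (range γ) := hrange ▸ isCompact_Icc.image hγ
  have hγT : γ T = γ 0 := by simpa using hper 0
  have hu0 : 0 < (γ 0).1 - 1 := hup.u_left
  have hu1 : (γ t₁).1 - 1 < 0 := hup.u_right
  have hy0 : (γ 0).2 = 0 := hup.y_left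
  have hy1 : (γ t₁).2 = 0 := hup.y_right
  have hcases : ∀ g ∈ range γ, (∃ t ∈ Ioo 0 t₁, γ t = g ∧ 0 < g.2) ∨
      (∃ t ∈ Ioo t₁ T, γ t = g ∧ g.2 < 0) ∨ (g.2 = 0 ∧ (g = γ 0 ∨ g = γ t₁)) := by
    intro g hg
    rw [hrange] at hg
    obtain ⟨t, ht, rfl⟩ := hg
    rcases ht.1.eq_or_lt with h | h
    · subst h; exact Or.inr (Or.inr ⟨hy0, Or.inl rfl⟩)
    rcases ht.2.eq_or_lt with h' | h'
    · subst h'; exact Or.inr (Or.inr ⟨by rw [hγT, hy0], Or.inl hγT⟩)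
    rcases lt_trichotomy t t₁ with h'' | h'' | h''
    · exact Or.inl ⟨t, ⟨h, h''⟩, rfl, hup.y_pos t ⟨h, h''⟩⟩
    · subst h''; exact Or.inr (Or.inr ⟨hy1, Or.inr rfl⟩)
    · exact Or.inr (Or.inl ⟨t, ⟨h'', h'⟩, rfl, by linarith [hlo.y_pos t ⟨h'', h'⟩]⟩)
  have hp : ((1, 0) : ℝ × ℝ) ∉ range γ := by
    intro hmem
    rcases hcases _ hmem with ⟨t, ht, -, h2⟩ | ⟨t, ht, -, h2⟩ | ⟨-, h | h⟩
    · simp at h2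
    · simp at h2
    · rw [← h] at hu0; simp at hu0
    · rw [← h] at hu1; simp at hu1
  refine ⟨hp, ?_⟩
  set Dl : ℝ × (ℝ × ℝ) → ℝ × ℝ := fun z ↦ (1 + z.1 ^ 2 * (z.2.1 - 1), z.1 * z.2.2) with hDl
  have hDc : Continuous Dl := by simp only [hDl]; fun_prop
  have hinj : ∀ g ∈ range γ, ∀ l ∈ Icc (0 : ℝ) 1, Dl (l, g) ∈ range γ → l = 1 := by
    intro g hg l hl hg'
    have hl0 : 0 < l := by
      refine hl.1.lt_of_ne fun h ↦ hp ?_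
      rw [← h] at hg'
      simpa [hDl] using hg'
    rcases hcases g hg with ⟨t, ht, rfl, h2⟩ | ⟨t, ht, rfl, h2⟩ | ⟨h0, h⟩
    · rcases hcases _ hg' with ⟨s, hs, hst, h3⟩ | ⟨s, hs, -, h3⟩ | ⟨h3, -⟩
      · exact hup.dilation_eq_one ht hs hl0 (by simp [hst, hDl]) (by simp [hst, hDl])
      · simp only [hDl] at h3; nlinarith
      · simp only [hDl] at h3; nlinarith
    · rcases hcases _ hg' with ⟨s, hs, -, h3⟩ | ⟨s, hs, hst, h3⟩ | ⟨h3, -⟩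
      · simp only [hDl] at h3; nlinarith
      · exact hlo.dilation_eq_one ht hs hl0 (by simp only [hst, hDl]; ring)
          (by simp only [hst, hDl]; ring)
      · simp only [hDl] at h3; nlinarith
    · rcases hcases _ hg' with ⟨s, hs, -, h3⟩ | ⟨s, hs, -, h3⟩ | ⟨-, h3⟩
      · simp [hDl, h0] at h3
      · simp [hDl, h0] at h3
      · have hl2 : l ^ 2 = 1 := by
          rcases h with rfl | rfl <;> rcases h3 with h3 | h3
          · have := congrArg Prod.fst h3
            simp only [hDl] at this
            exact mul_right_cancel₀ hu0.ne' (by linarith)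
          · have := congrArg Prod.fst h3
            simp only [hDl] at this
            have := mul_pos (pow_pos hl0 2) hu0
            linarith
          · have := congrArg Prod.fst h3
            simp only [hDl] at this
            have := mul_neg_of_pos_of_neg (pow_pos hl0 2) hu1
            linarith
          · have := congrArg Prod.fst h3
            simp only [hDl] at this
            exact mul_right_cancel₀ hu1.ne (by linarith)
        nlinarith
  have hcover : ∀ q : ℝ × ℝ, q ≠ (1, 0) → ∃ l > 0, ∃ g ∈ range γ, q = Dl (l, g) := by
    intro q hq
    rcases lt_trichotomy q.2 0 with h | h | h
    · obtain ⟨t, -, l, hl, h1, h2⟩ :=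
        hlo.exists_dilation (v := -(q.1 - 1)) (z := -q.2) (by linarith)
      refine ⟨l, hl, γ t, mem_range_self t, Prod.ext ?_ ?_⟩ <;> simp only [hDl] <;> linarith
    · have hq1 : q.1 - 1 ≠ 0 := fun h' ↦ hq (Prod.ext (by simp; linarith) h)
      have haux : ∀ g ∈ range γ, g.2 = 0 → 0 < (q.1 - 1) / (g.1 - 1) →
          ∃ l > 0, ∃ g ∈ range γ, q = Dl (l, g) := by
        intro g hg hg2 hpos
        refine ⟨√((q.1 - 1) / (g.1 - 1)), Real.sqrt_pos.2 hpos, g, hg, Prod.ext ?_ ?_⟩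
        · simp only [hDl]
          rw [Real.sq_sqrt hpos.le, div_mul_cancel₀]
          · ring
          · rintro h'
            rw [h'] at hpos; simp at hpos
        · simp [hDl, h, hg2]
      rcases hq1.lt_or_gt with h' | h'
      · exact haux _ (mem_range_self t₁) hy1 (div_pos_of_neg_of_neg h' hu1)
      · exact haux _ (mem_range_self 0) hy0 (div_pos h' hu0)
    · obtain ⟨t, -, l, hl, h1, h2⟩ := hup.exists_dilation (v := q.1 - 1) (z := q.2) h
      refine ⟨l, hl, γ t, mem_range_self t, Prod.ext ?_ ?_⟩ <;> simp only [hDl] <;> linarith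
  have hDmul : ∀ (l m : ℝ) (q : ℝ × ℝ), Dl (l, Dl (m, q)) = Dl (l * m, q) := fun l m q ↦ by
    ext <;> simp [hDl] <;> ring
  have hDone : ∀ q : ℝ × ℝ, Dl (1, q) = q := fun q ↦ by ext <;> simp [hDl]
  -- `I` is the orbit with its inside and `O` the orbit with its outside. They are closed, cover the
  -- plane and meet only in the orbit, so a connected set that avoids the orbit and contains `(1,
  -- 0)` stays in the compact set `I`.
  set I : Set (ℝ × ℝ) := Dl '' (Icc 0 1 ×ˢ range γ)
  set O : Set (ℝ × ℝ) := Prod.snd '' ((Icc (0 : ℝ) 1 ×ˢ univ) ∩ Dl ⁻¹' range γ)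
  have hI : IsCompact I := (isCompact_Icc.prod hcpt).image hDc
  have hO : IsClosed O := by
    have : O = Prod.snd '' {z : Icc (0 : ℝ) 1 × (ℝ × ℝ) | Dl (z.1, z.2) ∈ range γ} := by
      ext q
      simp only [O, mem_image, mem_inter_iff, mem_prod, mem_univ, and_true, mem_preimage,
        Prod.exists, exists_eq_right, mem_ofPred_eq, Subtype.exists]
      constructor
      · rintro ⟨l, hl, h⟩; exact ⟨l, hl, h⟩
      · rintro ⟨l, hl, h⟩; exact ⟨l, hl, h⟩
    rw [this]
    refine isClosedMap_snd_of_compactSpace _ (hcpt.isClosed.preimage ?_)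
    fun_prop
  have hpI : ((1, 0) : ℝ × ℝ) ∈ I :=
    ⟨(0, γ 0), ⟨⟨le_rfl, zero_le_one⟩, mem_range_self 0⟩, by simp [hDl]⟩
  have h_union : ∀ q, q ∈ I ∪ O := by
    intro q
    by_cases hq : q = (1, 0)
    · exact Or.inl (hq ▸ hpI)
    obtain ⟨l, hl, g, hg, rfl⟩ := hcover q hq
    rcases le_total l 1 with h | h
    · exact Or.inl ⟨(l, g), ⟨⟨hl.le, h⟩, hg⟩, rfl⟩
    · refine Or.inr ⟨(l⁻¹, Dl (l, g)), ⟨⟨⟨by positivity, inv_le_one_of_one_le₀ h⟩, trivial⟩, ?_⟩, rfl⟩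
      rw [mem_preimage, hDmul, inv_mul_cancel₀ hl.ne', hDone]
      exact hg
  have h_inter : I ∩ O ⊆ range γ := by
    rintro q ⟨⟨⟨l, g⟩, ⟨hl, hg⟩, rfl⟩, ⟨⟨m, q'⟩, ⟨⟨hm, -⟩, hmem⟩, hq'⟩⟩
    simp only at hq' hl hg hm
    subst hq'
    rw [mem_preimage, hDmul] at hmem
    have h1 := hinj g hg (m * l) ⟨mul_nonneg hm.1 hl.1, mul_le_one₀ hm.2 hl.1 hl.2⟩ hmem
    have hl1 : l = 1 := by
      have := mul_le_of_le_one_left hl.1 hm.2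
      exact le_antisymm hl.2 (by linarith)
    rw [hl1, hDone]
    exact hg
  refine hI.isBounded.subset fun q hq ↦ ?_
  by_contra hqI
  have hqO : q ∈ O := (h_union q).resolve_left hqI
  have hsub := connectedComponentIn_subset (range γ)ᶜ ((1, 0) : ℝ × ℝ)
  obtain ⟨z, hz, hz_mem⟩ := isPreconnected_closed_iff.1
    (isPreconnected_connectedComponentIn (F := (range γ)ᶜ) (x := ((1, 0) : ℝ × ℝ))) I O hI.isClosed hO
    (fun z _ ↦ h_union z) ⟨_, mem_connectedComponentIn hp, hpI⟩ ⟨q, hq, hqO⟩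
  exact hsub hz (h_inter hz_mem)

end TurningArc

/-! ### From half-turns and closing to a center. -/

section Center

open Set Filter Topology Bornology NNReal

theorem HasDerivAt.fst_prod {γ : ℝ → ℝ × ℝ} {v : ℝ × ℝ} {t : ℝ} (h : HasDerivAt γ v t) :
    HasDerivAt (fun s ↦ (γ s).1) v.1 t :=
  (ContinuousLinearMap.fst ℝ ℝ ℝ).hasFDerivAt.comp_hasDerivAt t h

theorem HasDerivAt.snd_prod {γ : ℝ → ℝ × ℝ} {v : ℝ × ℝ} {t : ℝ} (h : HasDerivAt γ v t) :
    HasDerivAt (fun s ↦ (γ s).2) v.2 t :=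
  (ContinuousLinearMap.snd ℝ ℝ ℝ).hasFDerivAt.comp_hasDerivAt t h

theorem HasDerivAt.comp_time_shift {γ : ℝ → ℝ × ℝ} {v : ℝ × ℝ} {t a : ℝ}
    (h : HasDerivAt γ v (t + a)) : HasDerivAt (fun s ↦ γ (s + a)) v t :=
  h.comp_add_const t a

/-- In the closed upper half-plane, trajectories of the planar field `f` whose initial energy is
small reach the negative half-axis. -/
structure HasHalfTurns (f : ℝ → ℝ → ℝ × ℝ) (E : ℝ → ℝ → ℝ) (ε M : ℝ) : Prop where
  ε_pos : 0 < ε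
  one_le : 1 ≤ M
  continuous_energy : Continuous fun q : ℝ × ℝ ↦ E q.1 q.2
  energy_ge : ∀ u y, 0 ≤ y → u ^ 2 + y ^ 4 ≤ E u y
  energy_axis : ∀ u, E u 0 = u ^ 2
  turn : ∀ u y : ℝ → ℝ, Continuous u → Continuous y →
    (∀ t, 0 ≤ y t → |u t| ≤ 1 → |y t| ≤ 1 →
      HasDerivAt u (f (u t) (y t)).1 t ∧ HasDerivAt y (f (u t) (y t)).2 t) →
    0 ≤ y 0 → (y 0 = 0 → 0 < u 0) → E (u 0) (y 0) * M < ε →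
    ∃ t₁ > 0, y t₁ = 0 ∧ u t₁ < 0 ∧ (∀ t ∈ Ioo 0 t₁, 0 < y t) ∧
      (∀ t ∈ Icc 0 t₁, E (u t) (y t) ≤ E (u 0) (y 0) * M) ∧
      StrictAntiOn (fun t ↦ u t / y t ^ 2) (Ioo 0 t₁)

theorem HasHalfTurns.weaken {f : ℝ → ℝ → ℝ × ℝ} {E : ℝ → ℝ → ℝ} {ε M ε' M' : ℝ}
    (h : HasHalfTurns f E ε M) (hε : 0 < ε') (hε' : ε' ≤ ε) (hM : M ≤ M') :
    HasHalfTurns f E ε' M' where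
  ε_pos := hε
  one_le := h.one_le.trans hM
  continuous_energy := h.continuous_energy
  energy_ge := h.energy_ge
  energy_axis := h.energy_axis
  turn u y hu hy hd h0 h0' hs := by
    have hE : 0 ≤ E (u 0) (y 0) := le_trans (by positivity) (h.energy_ge _ _ h0)
    have hle : E (u 0) (y 0) * M ≤ E (u 0) (y 0) * M' := by gcongr
    obtain ⟨t, ht, h1, h2, h3, h4, h5⟩ := h.turn u y hu hy hd h0 h0' (by linarith)
    exact ⟨t, ht, h1, h2, h3, fun s hs ↦ (h4 s hs).trans hle, h5⟩

theorem nil_hasHalfTurns {α p₁ p₂ p₃ p₄ q₁ q₂ q₃ q₄ q₅ q₆ q₇ : ℝ} (hα : 0 ≤ α)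
    (h : 0 < α ∨ (p₂ - 2 * q₅) ^ 2 + 8 * p₄ < 0) {f : ℝ → ℝ → ℝ × ℝ}
    (hf : ∀ u y, 0 ≤ y → f u y = (nilFst α p₁ p₂ p₃ p₄ u y, nilSnd q₁ q₂ q₃ q₄ q₅ q₆ q₇ u y)) :
    ∃ ε M, HasHalfTurns f (nilEnergy α) ε M := by
  obtain ⟨ε, hε, M, hM, hturn⟩ := nil_exists_half_turn (p₁ := p₁) (p₃ := p₃) (q₁ := q₁) (q₂ := q₂)
    (q₃ := q₃) (q₄ := q₄) (q₆ := q₆) (q₇ := q₇) hα h one_pos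
  refine ⟨ε, M, hε, hM, by simp only [nilEnergy]; fun_prop, fun u y hy ↦ nilEnergy_ge hα hy,
    fun u ↦ by simp [nilEnergy], fun u y hu hy hd ↦ hturn u y hu hy fun t h1 h2 h3 ↦ ?_⟩
  have := hd t h1 h2 h3
  rwa [hf _ _ h1] at this

theorem abs_le_of_energy_bound {u y r : ℝ} (hr : 0 ≤ r) (hr1 : r ≤ 1)
    (h : u ^ 2 + y ^ 4 ≤ r ^ 4) : |u| ≤ r ∧ |y| ≤ r := by
  have h2 : r ^ 4 ≤ r ^ 2 := pow_le_pow_of_le_one hr hr1 (by norm_num)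
  constructor
  · exact abs_le_of_sq_le_sq (by nlinarith [sq_nonneg (y ^ 2)]) hr
  · refine le_of_pow_le_pow_left₀ (n := 4) (by norm_num) hr ?_
    have : |y| ^ 4 = y ^ 4 := Even.pow_abs (by decide) y
    nlinarith [sq_nonneg u]

/-- The trajectories of `X` near `(1, 0)` close up after one turn. (The trajectories are those of a
globally Lipschitz field `Y` which agrees with `X` near `(1, 0)`.) -/
def ClosesUp (X : ℝ × ℝ → ℝ × ℝ) (r : ℝ) : Prop :=
  ∀ (Y : ℝ × ℝ → ℝ × ℝ) (K : ℝ≥0), LipschitzWith K Y →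
    (∀ q : ℝ × ℝ, |q.1| ≤ 3 → |q.2| ≤ 3 → Y q = X q) →
    ∀ γ : ℝ → ℝ × ℝ, (∀ t, HasDerivAt γ (Y (γ t)) t) → ∀ t₁ T : ℝ,
    IsTurningArc (fun t ↦ (γ t).1 - 1) (fun t ↦ (γ t).2) 0 t₁ →
    IsTurningArc (fun t ↦ -((γ t).1 - 1)) (fun t ↦ -(γ t).2) t₁ T →
    (∀ t ∈ Icc 0 T, |(γ t).1 - 1| ≤ r ∧ |(γ t).2| ≤ r) → γ T = γ 0

/-- A field all of whose small trajectories turn around `(1, 0)` has a center there as soon as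
these trajectories close up after one turn. -/
theorem SwitchingSystem.isCenter_of_halfTurns {S : SwitchingSystem} {X : ℝ × ℝ → ℝ × ℝ}
    (hX : ContDiff ℝ 1 X) (hv : ∀ q, S.velocities q = {X q})
    {E₁ E₂ : ℝ → ℝ → ℝ} {ε₁ ε₂ M₁ M₂ : ℝ}
    (hup : HasHalfTurns (fun u y ↦ X (1 + u, y)) E₁ ε₁ M₁)
    (hlo : HasHalfTurns (fun u y ↦ -X (1 - u, -y)) E₂ ε₂ M₂)
    {r : ℝ} (hr : 0 < r)
    (hclose : ClosesUp X r) :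
    S.IsCenter (1, 0) := by
  set ρ := min r 1
  have hρ : 0 < ρ := lt_min hr one_pos
  have hρ1 : ρ ≤ 1 := min_le_right _ _
  have hρr : ρ ≤ r := min_le_left _ _
  -- The bound `ρ ^ 4` converts small energy into confinement to the box of radius `ρ`.
  set ε := min (min ε₁ ε₂) (ρ ^ 4)
  have hε : 0 < ε := lt_min (lt_min hup.ε_pos hlo.ε_pos) (by positivity)
  have hερ : ε ≤ ρ ^ 4 := min_le_right _ _
  set M := max M₁ M₂
  have hup := hup.weaken hε ((min_le_left _ _).trans (min_le_left _ _)) (le_max_left M₁ M₂)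
  have hlo := hlo.weaken hε ((min_le_left _ _).trans (min_le_right _ _)) (le_max_right M₁ M₂)
  change HasHalfTurns _ E₁ ε M at hup
  change HasHalfTurns _ E₂ ε M at hlo
  have hM : 1 ≤ M := hup.one_le
  have hM0 : 0 < M := one_pos.trans_le hM
  clear_value ε M ρ
  -- The truncation makes trajectories global before they are known to stay near `(1, 0)`;
  -- afterwards they turn out to be trajectories of `X`.
  obtain ⟨Y, K, L, hYK, hYL, hYX⟩ := exists_lipschitz_truncation hX 3
  have hbox : ∀ q : ℝ × ℝ, |q.1 - 1| ≤ 1 → |q.2| ≤ 1 → Y q = X q := fun q h1 h2 ↦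
    hYX q (by rw [abs_le] at *; constructor <;> linarith) (by linarith)
  have huniq : ∀ {γ δ : ℝ → ℝ × ℝ}, (∀ t, HasDerivAt γ (Y (γ t)) t) →
      (∀ t, HasDerivAt δ (Y (δ t)) t) → γ 0 = δ 0 → γ = δ := fun hγ hδ h0 ↦
    ODE_solution_unique_univ (v := fun _ ↦ Y) (s := fun _ ↦ univ)
      (fun _ ↦ hYK.lipschitzOnWith) (fun t ↦ ⟨hγ t, trivial⟩) (fun t ↦ ⟨hδ t, trivial⟩) h0
  have hcont : ∀ {γ : ℝ → ℝ × ℝ}, (∀ t, HasDerivAt γ (Y (γ t)) t) → Continuous γ := fun hγ ↦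
    continuous_iff_continuousAt.2 fun t ↦ (hγ t).continuousAt
  have upper : ∀ γ : ℝ → ℝ × ℝ, (∀ t, HasDerivAt γ (Y (γ t)) t) → 0 ≤ (γ 0).2 →
      ((γ 0).2 = 0 → 0 < (γ 0).1 - 1) → E₁ ((γ 0).1 - 1) (γ 0).2 * M < ε →
      ∃ t₁ > 0, (γ t₁).2 = 0 ∧ (γ t₁).1 - 1 < 0 ∧
        ((γ t₁).1 - 1) ^ 2 ≤ E₁ ((γ 0).1 - 1) (γ 0).2 * M ∧
        (∀ t ∈ Icc 0 t₁, |(γ t).1 - 1| ≤ ρ ∧ |(γ t).2| ≤ ρ) ∧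
        ((γ 0).2 = 0 → IsTurningArc (fun t ↦ (γ t).1 - 1) (fun t ↦ (γ t).2) 0 t₁) := by
    intro γ hγ h0 h0' hs
    have hγc := hcont hγ
    have hu : Continuous fun t ↦ (γ t).1 - 1 := by fun_prop
    have hy : Continuous fun t ↦ (γ t).2 := by fun_prop
    obtain ⟨t₁, ht₁, h1, h2, h3, h4, h5⟩ := hup.turn (fun t ↦ (γ t).1 - 1) (fun t ↦ (γ t).2) hu hy
      (fun t _ h2 h3 ↦ by
        have hq : Y (γ t) = X (1 + ((γ t).1 - 1), (γ t).2) := by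
          rw [hbox _ h2 h3]; congr 1; ext <;> simp
        have hd := hγ t
        rw [hq] at hd
        exact ⟨hd.fst_prod.sub_const 1, hd.snd_prod⟩) h0 h0' hs
    have hpos : ∀ t ∈ Icc 0 t₁, 0 ≤ (γ t).2 := by
      intro t ht
      rcases ht.1.eq_or_lt with h | h
      · rw [← h]; exact h0
      rcases ht.2.eq_or_lt with h' | h'
      · rw [h', h1]
      · exact (h3 t ⟨h, h'⟩).le
    refine ⟨t₁, ht₁, h1, h2, ?_, fun t ht ↦ ?_, fun h0'' ↦
      ⟨ht₁, hu, hy, h0'', h1, h0' h0'', h2, h3, h5⟩⟩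
    · have := h4 t₁ ⟨ht₁.le, le_rfl⟩
      simp only [h1, hup.energy_axis] at this
      exact this
    · exact abs_le_of_energy_bound hρ.le hρ1 (((hup.energy_ge _ _ (hpos t ht)).trans (h4 t ht)).trans
        (by linarith))
  have lower : ∀ γ : ℝ → ℝ × ℝ, (∀ t, HasDerivAt γ (Y (γ t)) t) → (γ 0).2 ≤ 0 →
      ((γ 0).2 = 0 → (γ 0).1 - 1 < 0) → E₂ (-((γ 0).1 - 1)) (-(γ 0).2) * M < ε →
      ∃ t₁ > 0, (γ t₁).2 = 0 ∧ 0 < (γ t₁).1 - 1 ∧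
        ((γ t₁).1 - 1) ^ 2 ≤ E₂ (-((γ 0).1 - 1)) (-(γ 0).2) * M ∧
        (∀ t ∈ Icc 0 t₁, |(γ t).1 - 1| ≤ ρ ∧ |(γ t).2| ≤ ρ) ∧
        ((γ 0).2 = 0 → IsTurningArc (fun t ↦ -((γ t).1 - 1)) (fun t ↦ -(γ t).2) 0 t₁) := by
    intro γ hγ h0 h0' hs
    have hγc := hcont hγ
    have hu : Continuous fun t ↦ -((γ t).1 - 1) := by fun_prop
    have hy : Continuous fun t ↦ -(γ t).2 := by fun_prop
    obtain ⟨t₁, ht₁, h1, h2, h3, h4, h5⟩ := hlo.turn (fun t ↦ -((γ t).1 - 1)) (fun t ↦ -(γ t).2)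
      hu hy
      (fun t _ h2 h3 ↦ by
        rw [abs_neg] at h2 h3
        have hq : Y (γ t) = X (1 - -((γ t).1 - 1), - -(γ t).2) := by
          rw [hbox _ h2 h3]; congr 1; ext <;> simp
        have hd := hγ t
        rw [hq] at hd
        exact ⟨(hd.fst_prod.sub_const 1).neg, hd.snd_prod.neg⟩) (by simpa using h0)
        (fun h ↦ by have := h0' (by simpa using h); simpa using this) hs
    have hpos : ∀ t ∈ Icc 0 t₁, 0 ≤ -(γ t).2 := by
      intro t ht
      rcases ht.1.eq_or_lt with h | h
      · rw [← h]; simpa using h0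
      rcases ht.2.eq_or_lt with h' | h'
      · rw [h', h1]
      · exact (h3 t ⟨h, h'⟩).le
    refine ⟨t₁, ht₁, by simpa using h1, by linarith, ?_, fun t ht ↦ ?_, fun h0'' ↦
      ⟨ht₁, hu, hy, by simpa using h0'', h1, by linarith [h0' h0''], h2, h3, h5⟩⟩
    · have := h4 t₁ ⟨ht₁.le, le_rfl⟩
      simp only [h1, hlo.energy_axis] at this
      rwa [neg_sq] at this
    · have := abs_le_of_energy_bound hρ.le hρ1
        (((hlo.energy_ge _ _ (hpos t ht)).trans (h4 t ht)).trans (by linarith))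
      simpa only [abs_neg] using this
  set Good : (ℝ → ℝ × ℝ) → Prop := fun γ ↦ ∃ T : ℝ, 0 < T ∧ Function.Periodic γ T ∧
    (∀ t, HasDerivAt γ (X (γ t)) t) ∧ ((1, 0) : ℝ × ℝ) ∉ range γ ∧
    IsBounded (connectedComponentIn (range γ)ᶜ ((1, 0) : ℝ × ℝ))
  have hshift : ∀ (γ : ℝ → ℝ × ℝ) (a : ℝ), Good (fun t ↦ γ (t + a)) → Good γ := by
    rintro γ a ⟨T, hT, hper, hd, hp, hb⟩
    have hrg : range (fun t ↦ γ (t + a)) = range γ :=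
      (Equiv.addRight a).surjective.range_comp γ
    rw [hrg] at hp hb
    refine ⟨T, hT, fun t ↦ ?_, fun t ↦ ?_, hp, hb⟩
    · have := hper (t - a)
      simp only at this
      convert this using 2 <;> ring
    · have := (show HasDerivAt (fun s ↦ γ (s + a)) (X (γ t)) (t - a) by
        simpa using hd (t - a))
      simpa using this.comp_add_const t (-a)
  -- Each half-turn may multiply the energy by `M`. Two are needed from the positive half-axis, a
  -- third when starting below, and a fourth when starting above; hence the powers `M ^ 2`, `M ^ 3`,
  -- `M ^ 4`.
  have good_axis : ∀ γ : ℝ → ℝ × ℝ, (∀ t, HasDerivAt γ (Y (γ t)) t) → (γ 0).2 = 0 →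
      0 < (γ 0).1 - 1 → ((γ 0).1 - 1) ^ 2 * M ^ 2 < ε → Good γ := by
    intro γ hγ h0 h0' hs
    have hsq : ((γ 0).1 - 1) ^ 2 * M ≤ ((γ 0).1 - 1) ^ 2 * M ^ 2 := by
      gcongr
      exact le_self_pow₀ hM (by norm_num)
    obtain ⟨t₁, ht₁, a1, a2, a3, a4, a5⟩ := upper γ hγ h0.ge (fun _ ↦ h0')
      (by rw [h0, hup.energy_axis]; linarith)
    rw [h0, hup.energy_axis] at a3
    have hγ' : ∀ t, HasDerivAt (fun s ↦ γ (s + t₁)) (Y (γ (t + t₁))) t := fun t ↦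
      (hγ (t + t₁)).comp_time_shift
    obtain ⟨t₂, ht₂, b1, b2, -, b4, b5⟩ := lower (fun s ↦ γ (s + t₁)) hγ' (by simp [a1])
      (fun _ ↦ by simpa using a2) (by
        simp only [zero_add, a1, neg_zero, hlo.energy_axis, neg_sq]
        have := mul_le_mul_of_nonneg_right a3 hM0.le
        nlinarith)
    have arc1 := a5 h0
    have arc2 : IsTurningArc (fun t ↦ -((γ t).1 - 1)) (fun t ↦ -(γ t).2) t₁ (t₂ + t₁) := by
      have h := b5 (by simp [a1])
      have hγc := hcont hγ
      refine ⟨by linarith, by fun_prop, by fun_prop, by simpa using h.y_left,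
        by simpa using h.y_right, by simpa using h.u_left, by simpa using h.u_right, ?_, ?_⟩
      · intro t ht
        have := h.y_pos (t - t₁) ⟨by linarith [ht.1], by linarith [ht.2]⟩
        simpa using this
      · intro s hs t ht hst
        have := h.anti (show s - t₁ ∈ Ioo 0 t₂ from ⟨by linarith [hs.1], by linarith [hs.2]⟩)
          (show t - t₁ ∈ Ioo 0 t₂ from ⟨by linarith [ht.1], by linarith [ht.2]⟩) (by linarith)
        simpa using this
    have hsmall : ∀ t ∈ Icc 0 (t₂ + t₁), |(γ t).1 - 1| ≤ ρ ∧ |(γ t).2| ≤ ρ := by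
      intro t ht
      rcases le_total t t₁ with h | h
      · exact a4 t ⟨ht.1, h⟩
      · have := b4 (t - t₁) ⟨by linarith, by linarith [ht.2]⟩
        simpa using this
    have hret : γ (t₂ + t₁) = γ 0 := hclose Y K hYK hYX γ hγ t₁ _ arc1 arc2 fun t ht ↦
      ⟨(hsmall t ht).1.trans hρr, (hsmall t ht).2.trans hρr⟩
    have hper : Function.Periodic γ (t₂ + t₁) := by
      have := huniq (γ := fun s ↦ γ (s + (t₂ + t₁))) (δ := γ)
        (fun t ↦ (hγ (t + (t₂ + t₁))).comp_time_shift) hγ (by simpa using hret)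
      exact fun t ↦ congrFun this t
    have hT : 0 < t₂ + t₁ := by linarith
    obtain ⟨hp, hb⟩ := isBounded_connectedComponentIn_of_turningArcs (hcont hγ) hper arc1 arc2
    refine ⟨t₂ + t₁, hT, hper, fun t ↦ ?_, hp, hb⟩
    have ht : γ t ∈ γ '' Icc 0 (0 + (t₂ + t₁)) := by
      rw [hper.image_Icc hT 0]; exact mem_range_self t
    obtain ⟨s, hs, hst⟩ := ht
    have := hsmall s (by simpa using hs)
    rw [← hbox (γ t) (by rw [← hst]; linarith) (by rw [← hst]; linarith)]
    exact hγ t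
  have good_lower : ∀ γ : ℝ → ℝ × ℝ, (∀ t, HasDerivAt γ (Y (γ t)) t) → (γ 0).2 ≤ 0 →
      ((γ 0).2 = 0 → (γ 0).1 - 1 < 0) → E₂ (-((γ 0).1 - 1)) (-(γ 0).2) * M ^ 3 < ε → Good γ := by
    intro γ hγ h0 h0' hs
    have hE : 0 ≤ E₂ (-((γ 0).1 - 1)) (-(γ 0).2) :=
      le_trans (by positivity) (hlo.energy_ge _ _ (by linarith))
    have hsq : E₂ (-((γ 0).1 - 1)) (-(γ 0).2) * M ≤ E₂ (-((γ 0).1 - 1)) (-(γ 0).2) * M ^ 3 := by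
      gcongr
      exact le_self_pow₀ hM (by norm_num)
    obtain ⟨t₁, ht₁, a1, a2, a3, -, -⟩ := lower γ hγ h0 h0' (by linarith)
    refine hshift γ t₁ (good_axis (fun s ↦ γ (s + t₁))
      (fun t ↦ (hγ (t + t₁)).comp_time_shift) (by simpa using a1) (by simpa using a2) ?_)
    have := mul_le_mul_of_nonneg_right a3 (sq_nonneg M)
    simp only [zero_add]
    nlinarith
  have good_upper : ∀ γ : ℝ → ℝ × ℝ, (∀ t, HasDerivAt γ (Y (γ t)) t) → 0 ≤ (γ 0).2 →
      ((γ 0).2 = 0 → 0 < (γ 0).1 - 1) → E₁ ((γ 0).1 - 1) (γ 0).2 * M ^ 4 < ε → Good γ := by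
    intro γ hγ h0 h0' hs
    have hE : 0 ≤ E₁ ((γ 0).1 - 1) (γ 0).2 := le_trans (by positivity) (hup.energy_ge _ _ h0)
    have hsq : E₁ ((γ 0).1 - 1) (γ 0).2 * M ≤ E₁ ((γ 0).1 - 1) (γ 0).2 * M ^ 4 := by
      gcongr
      exact le_self_pow₀ hM (by norm_num)
    obtain ⟨t₁, ht₁, a1, a2, a3, -, -⟩ := upper γ hγ h0 h0' (by linarith)
    refine hshift γ t₁ (good_lower (fun s ↦ γ (s + t₁))
      (fun t ↦ (hγ (t + t₁)).comp_time_shift) (by simp [a1]) (fun _ ↦ by simpa using a2) ?_)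
    have := mul_le_mul_of_nonneg_right a3 (pow_nonneg hM0.le 3)
    simp only [zero_add, a1, neg_zero, hlo.energy_axis, neg_sq]
    nlinarith
  -- A union of whole orbits is invariant, so each periodic orbit automatically stays in the
  -- neighbourhood.
  refine ⟨{q | q = (1, 0) ∨ ∃ γ, Good γ ∧ γ 0 = q}, ?_, ?_⟩
  · have n1 : ∀ᶠ q in 𝓝 ((1, 0) : ℝ × ℝ), E₁ (q.1 - 1) q.2 * M ^ 4 < ε := by
      have hc : Continuous fun q : ℝ × ℝ ↦ E₁ (q.1 - 1) q.2 * M ^ 4 :=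
        (hup.continuous_energy.comp (f := fun q : ℝ × ℝ ↦ (q.1 - 1, q.2))
          (by fun_prop)).mul continuous_const
      refine hc.continuousAt.eventually_lt continuousAt_const ?_
      simpa [hup.energy_axis] using hε
    have n2 : ∀ᶠ q in 𝓝 ((1, 0) : ℝ × ℝ), E₂ (-(q.1 - 1)) (-q.2) * M ^ 3 < ε := by
      have hc : Continuous fun q : ℝ × ℝ ↦ E₂ (-(q.1 - 1)) (-q.2) * M ^ 3 :=
        (hlo.continuous_energy.comp (f := fun q : ℝ × ℝ ↦ (-(q.1 - 1), -q.2))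
          (by fun_prop)).mul continuous_const
      refine hc.continuousAt.eventually_lt continuousAt_const ?_
      simpa [hlo.energy_axis] using hε
    filter_upwards [n1, n2] with q hq1 hq2
    by_cases hq : q = (1, 0)
    · exact Or.inl hq
    obtain ⟨γ, hγ0, hγ⟩ := exists_global_solution hYK hYL q
    refine Or.inr ⟨γ, ?_, hγ0⟩
    rw [← hγ0] at hq1 hq2 hq
    have hne : (γ 0).2 = 0 → (γ 0).1 - 1 ≠ 0 := fun h h' ↦
      hq (Prod.ext (by simp only; linarith) h)
    rcases lt_trichotomy (γ 0).2 0 with h | h | h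
    · exact good_lower γ hγ h.le (fun h' ↦ absurd h' h.ne) hq2
    · rcases (hne h).lt_or_gt with h' | h'
      · exact good_lower γ hγ h.le (fun _ ↦ h') hq2
      · exact good_upper γ hγ h.ge (fun _ ↦ h') hq1
    · exact good_upper γ hγ h.le (fun h' ↦ absurd h' h.ne') hq1
  · rintro q (rfl | ⟨γ, ⟨T, hT, hper, hd, hp, hb⟩, h0⟩) hq
    · exact absurd rfl hq
    refine ⟨γ, T, hT, hper, isSolutionOn_univ hX.continuous hv hd, h0, ?_, hp, hb,
      fun J δ hJ h0J hδ hδ0 ↦ hδ.eqOn hX hv hd hJ h0J (hδ0.trans h0.symm)⟩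
    rintro _ ⟨t, rfl⟩
    refine Or.inr ⟨fun s ↦ γ (s + t), ?_, by simp⟩
    refine hshift _ (-t) ?_
    simp only [neg_add_cancel_right]
    exact ⟨T, hT, hper, hd, hp, hb⟩

end Center

/-! ### Closing by first integrals or by reversibility. -/

section Closing

open Set Filter Topology Bornology NNReal

theorem eq_of_hasDerivAt_zero {f : ℝ → ℝ} {a b : ℝ} (hab : a ≤ b)
    (h : ∀ t ∈ Icc a b, HasDerivAt f 0 t) : f b = f a :=
  constant_of_has_deriv_right_zero (fun t ht ↦ (h t ht).continuousAt.continuousWithinAt)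
    (fun t ht ↦ (h t (Ico_subset_Icc_self ht)).hasDerivWithinAt) b ⟨hab, le_rfl⟩

/-- A trajectory that consists of an upper and a lower turning arc closes up if there are first
integrals in both half-planes that match on the axis. -/
theorem closing_of_firstIntegral {γ : ℝ → ℝ × ℝ} {t₁ T : ℝ}
    (hup : IsTurningArc (fun t ↦ (γ t).1 - 1) (fun t ↦ (γ t).2) 0 t₁)
    (hlo : IsTurningArc (fun t ↦ -((γ t).1 - 1)) (fun t ↦ -(γ t).2) t₁ T)
    {F₁ F₂ : ℝ → ℝ → ℝ} (hF : ∀ x, F₁ x 0 = F₂ x 0)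
    (h₁ : ∀ t ∈ Icc 0 t₁, HasDerivAt (fun t ↦ F₁ (γ t).1 (γ t).2) 0 t)
    (h₂ : ∀ t ∈ Icc t₁ T, HasDerivAt (fun t ↦ F₂ (γ t).1 (γ t).2) 0 t)
    (hinj : 1 < (γ 0).1 → 1 < (γ T).1 → F₁ (γ T).1 0 = F₁ (γ 0).1 0 → (γ T).1 = (γ 0).1) :
    γ T = γ 0 := by
  have e1 := eq_of_hasDerivAt_zero hup.lt.le h₁
  have e2 := eq_of_hasDerivAt_zero hlo.lt.le h₂
  have y0 : (γ 0).2 = 0 := hup.y_left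
  have y1 : (γ t₁).2 = 0 := hup.y_right
  have yT : (γ T).2 = 0 := by simpa using hlo.y_right
  have u0 := hup.u_left
  have uT := hlo.u_right
  simp only [y0, y1, yT] at e1 e2 u0 uT
  exact Prod.ext (hinj (by linarith) (by linarith) (by rw [← e1, hF, hF, e2])) (by rw [y0, yT])

/-- A trajectory that consists of an upper and a lower turning arc closes up if a map `R` sends the
upper arc to a piece of trajectory in the lower half-plane, up to a reversal and a change of
time. -/
theorem closing_of_reversible {Y : ℝ × ℝ → ℝ × ℝ} {K : ℝ≥0} (hY : LipschitzWith K Y)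
    {γ : ℝ → ℝ × ℝ} (hγ : ∀ t, HasDerivAt γ (Y (γ t)) t) {t₁ T : ℝ}
    (hup : IsTurningArc (fun t ↦ (γ t).1 - 1) (fun t ↦ (γ t).2) 0 t₁)
    (hlo : IsTurningArc (fun t ↦ -((γ t).1 - 1)) (fun t ↦ -(γ t).2) t₁ T)
    {R : ℝ × ℝ → ℝ × ℝ} {g : ℝ → ℝ} (hg : ContinuousOn g (Icc 0 t₁))
    (hgpos : ∀ t ∈ Icc 0 t₁, 0 < g t)
    (hR : ∀ t ∈ Icc 0 t₁, HasDerivAt (fun t ↦ R (γ t)) (-g t • Y (R (γ t))) t)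
    (hR0 : R (γ 0) = γ 0) (hR1 : R (γ t₁) = γ t₁)
    (hneg : ∀ t ∈ Ioo 0 t₁, (R (γ t)).2 < 0) : γ T = γ 0 := by
  have h01 : 0 ≤ t₁ := hup.lt.le
  set g' : ℝ → ℝ := IccExtend h01 ((Icc 0 t₁).domRestrict g)
  have hg' : Continuous g' := (continuousOn_iff_continuous_domRestrict.1 hg).Icc_extend'
  have hg'eq : ∀ t ∈ Icc 0 t₁, g' t = g t := fun t ht ↦ IccExtend_of_mem h01 _ ht
  -- This is the time change: both `γ (t₁ + τ t)` and `R (γ t)` solve `z' = -g' t • Y z` with the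
  -- same value at `t₁`. They coincide, and `t = 0` gives `γ (t₁ + τ 0) = γ 0`.
  set τ : ℝ → ℝ := fun t ↦ ∫ s in t..t₁, g' s
  have hτ : ∀ t, HasDerivAt τ (-g' t) t := fun t ↦
    intervalIntegral.integral_hasDerivAt_left (hg'.intervalIntegrable _ _)
      hg'.stronglyMeasurable.stronglyMeasurableAtFilter hg'.continuousAt
  have hτc : Continuous τ := continuous_iff_continuousAt.2 fun t ↦ (hτ t).continuousAt
  have hτ1 : τ t₁ = 0 := intervalIntegral.integral_same
  have hτ0 : 0 < τ 0 := intervalIntegral.intervalIntegral_pos_of_pos_on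
    (hg'.intervalIntegrable _ _)
    (fun t ht ↦ by rw [hg'eq t (Ioo_subset_Icc_self ht)]; exact hgpos t (Ioo_subset_Icc_self ht))
    hup.lt
  have hH : ∀ t, HasDerivAt (fun t ↦ γ (t₁ + τ t)) (-g' t • Y (γ (t₁ + τ t))) t := fun t ↦
    (hγ (t₁ + τ t)).scomp t ((hτ t).const_add t₁)
  obtain ⟨C, hC⟩ := isCompact_Icc.exists_bound_of_continuousOn (hg'.continuousOn (s := Icc 0 t₁))
  have hlip : ∀ t ∈ Ioc 0 t₁, LipschitzOnWith (C.toNNReal * K) (fun z ↦ -g' t • Y z) univ := by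
    intro t ht
    refine LipschitzOnWith.of_dist_le_mul fun z _ w _ ↦ ?_
    rw [dist_smul₀, norm_neg]
    have h1 := (hC t (Ioc_subset_Icc_self ht)).trans (Real.le_coe_toNNReal C)
    have h2 := hY.dist_le_mul z w
    push_cast
    rw [mul_assoc]
    exact mul_le_mul h1 h2 dist_nonneg (by positivity)
  have heq : EqOn (fun t ↦ γ (t₁ + τ t)) (fun t ↦ R (γ t)) (Icc 0 t₁) := by
    refine ODE_solution_unique_of_mem_Icc_left (v := fun t z ↦ -g' t • Y z) (s := fun _ ↦ univ) hlip
      (fun t _ ↦ (hH t).continuousAt.continuousWithinAt) (fun t _ ↦ (hH t).hasDerivWithinAt)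
      (fun _ _ ↦ trivial) (fun t ht ↦ (hR t ht).continuousAt.continuousWithinAt)
      (fun t ht ↦ ?_) (fun _ _ ↦ trivial) (by simp [hτ1, hR1])
    have ht' := Ioc_subset_Icc_self ht
    rw [hg'eq t ht']
    exact (hR t ht').hasDerivWithinAt
  have hend : γ (t₁ + τ 0) = γ 0 := (heq ⟨le_rfl, h01⟩).trans hR0
  have hbelow : ∀ s ∈ Ioo 0 (τ 0), (γ (t₁ + s)).2 < 0 := by
    intro s hs
    obtain ⟨t, ht, hts⟩ := intermediate_value_Icc' h01 hτc.continuousOn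
      (show s ∈ Icc (τ t₁) (τ 0) from ⟨by rw [hτ1]; exact hs.1.le, hs.2.le⟩)
    have ht' : t ∈ Ioo 0 t₁ := by
      refine ⟨ht.1.lt_of_ne ?_, ht.2.lt_of_ne ?_⟩
      · rintro rfl; exact hs.2.ne hts.symm
      · rintro rfl; exact hs.1.ne (hτ1 ▸ hts)
    have := heq ht
    simp only [hts] at this
    rw [this]
    exact hneg t ht'
  -- Both times are the first return to the axis after `t₁`, since the orbit lies strictly below the
  -- axis before each of them.
  have hT : T = t₁ + τ 0 := by
    rcases lt_trichotomy T (t₁ + τ 0) with h | h | h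
    · have h1 := hbelow (T - t₁) ⟨by linarith [hlo.lt], by linarith⟩
      have h2 := hlo.y_right
      rw [add_sub_cancel] at h1
      linarith
    · exact h
    · have h1 := hlo.y_pos (t₁ + τ 0) ⟨by linarith, h⟩
      have h2 : (γ 0).2 = 0 := hup.y_left
      rw [hend, h2] at h1
      simp at h1
  rw [hT, hend]

/-! ### Isolated nilpotent singular points. -/

section Nilpotent

variable {α p₁ p₂ p₃ p₄ q₁ q₂ q₃ q₄ q₅ q₆ q₇ : ℝ}

/-- Each polynomial field is considered on both sides of the axis here. Where `nil_rotation`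
applies, a definite combination of the components excludes other zeros. For `α > 0` and `y < 0` the
combination with `s = -2` is positive, because `-α y³` is then positive and dominant. -/
theorem nil_isolated (hα : 0 ≤ α) (h : 0 < α ∨ (p₂ - 2 * q₅) ^ 2 + 8 * p₄ < 0) :
    ∃ r > 0, ∀ u y : ℝ, |u| ≤ r → |y| ≤ r → nilFst α p₁ p₂ p₃ p₄ u y = 0 →
      nilSnd q₁ q₂ q₃ q₄ q₅ q₆ q₇ u y = 0 → u = 0 ∧ y = 0 := by
  obtain ⟨c, hc, r₁, hr₁, -, hrot⟩ := nil_rotation (p₁ := p₁) (p₃ := p₃) (q₁ := q₁) (q₂ := q₂)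
    (q₃ := q₃) (q₄ := q₄) (q₆ := q₆) (q₇ := q₇) hα h
  set K := |p₁| + |p₃| + |(-2) * q₁| + |(-2) * q₂| + |(-2) * q₃| + |(-2) * q₄| + |(-2) * q₆| +
    |(-2) * q₇|
  have hK : 0 ≤ K := by positivity
  set m := p₂ - (-2) * q₅
  obtain ⟨B, hBdef⟩ : ∃ B, B = m ^ 2 + |p₄| + K + 1 := ⟨_, rfl⟩
  have hB : 0 < B := by rw [hBdef]; positivity
  by_cases hα0 : α = 0
  · refine ⟨r₁, hr₁, fun u y hu hy h1 h2 ↦ ?_⟩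
    have := hrot u y hu hy (Or.inr hα0)
    rw [h1, h2] at this
    have hN : u ^ 2 + y ^ 4 ≤ 0 := by
      by_contra! hcon
      nlinarith
    have hu0 : u ^ 2 = 0 := by nlinarith [sq_nonneg u, sq_nonneg (y ^ 2)]
    have hy0 : y ^ 4 = 0 := by nlinarith [sq_nonneg u, sq_nonneg (y ^ 2)]
    exact ⟨by simpa using hu0, by simpa using hy0⟩
  have hαpos : 0 < α := hα.lt_of_ne' hα0
  set r := min (min r₁ 1) (min (α / (2 * B)) (1 / (2 * B)))
  have hr : 0 < r := by positivity
  have hrr₁ : r ≤ r₁ := (min_le_left _ _).trans (min_le_left _ _)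
  have hr1 : r ≤ 1 := (min_le_left _ _).trans (min_le_right _ _)
  have hrα : r * (2 * B) ≤ α := by
    have : r ≤ α / (2 * B) := (min_le_right _ _).trans (min_le_left _ _)
    rwa [le_div_iff₀ (by positivity)] at this
  have hrB : r * (2 * B) ≤ 1 := by
    have : r ≤ 1 / (2 * B) := (min_le_right _ _).trans (min_le_right _ _)
    rwa [le_div_iff₀ (by positivity)] at this
  refine ⟨r, hr, fun u y hu hy h1 h2 ↦ ?_⟩
  rcases le_or_gt 0 y with hy0 | hy0
  · have := hrot u y (hu.trans hrr₁) (hy.trans hrr₁) (Or.inl hy0)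
    rw [h1, h2] at this
    have hN : u ^ 2 + y ^ 4 ≤ 0 := by
      by_contra! hcon
      nlinarith
    have hu0 : u ^ 2 = 0 := by nlinarith [sq_nonneg u, sq_nonneg (y ^ 2)]
    have hy0 : y ^ 4 = 0 := by nlinarith [sq_nonneg u, sq_nonneg (y ^ 2)]
    exact ⟨by simpa using hu0, by simpa using hy0⟩
  · exfalso
    have h3 := (abs_le.1 (nil_rotation_remainder (α := α) (p₁ := p₁) (p₂ := p₂) (p₃ := p₃)
      (p₄ := p₄) (q₁ := q₁) (q₂ := q₂) (q₃ := q₃) (q₄ := q₄) (q₅ := q₅) (q₆ := q₆) (q₇ := q₇)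
      hr1 hu hy (-2))).1
    rw [h1, h2] at h3
    change -(K * (r * (u ^ 2 + y ^ 4))) ≤ _ at h3
    obtain ⟨z, rfl⟩ : ∃ z, y = -z := ⟨-y, by ring⟩
    have hz : 0 < z := by linarith
    rw [abs_neg, abs_of_pos hz] at hy
    have e1 : 0 ≤ (u + m * (-z) ^ 2 / 2) ^ 2 := sq_nonneg _
    have e2 := mul_le_mul_of_nonneg_right (neg_abs_le p₄) (by positivity : 0 ≤ z ^ 4)
    have hz3 : 0 < z ^ 3 := by positivity
    have hz4 : z ^ 4 ≤ r * z ^ 3 := by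
      have : z ^ 4 = z * z ^ 3 := by ring
      rw [this]; gcongr
    have e3 : B * z ^ 4 ≤ α / 2 * z ^ 3 := by
      calc B * z ^ 4 ≤ B * (r * z ^ 3) := by gcongr
        _ = (r * (2 * B)) / 2 * z ^ 3 := by ring
        _ ≤ α / 2 * z ^ 3 := by gcongr
    have e4 : K * r ≤ 1 := by
      have : K ≤ 2 * B := by linarith [sq_nonneg m, abs_nonneg p₄]
      nlinarith only [this, hrB, hr]
    have e5 := mul_le_mul_of_nonneg_right e4 (sq_nonneg u)
    have e6 : K * r * z ^ 4 ≤ K * z ^ 4 := by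
      have : K * r ≤ K := mul_le_of_le_one_right hK hr1
      gcongr
    have e7 : B * z ^ 4 = m ^ 2 * z ^ 4 + |p₄| * z ^ 4 + K * z ^ 4 + z ^ 4 := by
      rw [hBdef]; ring
    have e8 : 0 ≤ m ^ 2 * z ^ 4 := by positivity
    have e9 : 0 < α * z ^ 3 := by positivity
    change _ ≤ -z * 0 - -2 * u * 0 - (- -2 * u ^ 2 + m * (u * (-z) ^ 2) + p₄ * (-z) ^ 4 - α * (-z) ^ 3) at h3
    nlinarith only [h3, e1, e2, e3, e5, e6, e7, e8, e9, hz3]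

theorem hasFDerivAt_nil :
    HasFDerivAt (fun q : ℝ × ℝ ↦ (nilFst α p₁ p₂ p₃ p₄ q.1 q.2,
      nilSnd q₁ q₂ q₃ q₄ q₅ q₆ q₇ q.1 q.2))
      ((0 : ℝ × ℝ →L[ℝ] ℝ).prod (ContinuousLinearMap.fst ℝ ℝ ℝ)) 0 := by
  have hu : HasFDerivAt (fun q : ℝ × ℝ ↦ q.1) (ContinuousLinearMap.fst ℝ ℝ ℝ) 0 := hasFDerivAt_fst
  have hy : HasFDerivAt (fun q : ℝ × ℝ ↦ q.2) (ContinuousLinearMap.snd ℝ ℝ ℝ) 0 := hasFDerivAt_snd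
  refine HasFDerivAt.prodMk ?_ ?_
  · have := (((((hy.pow 2).const_mul (-α)).add ((hu.const_mul p₁).mul (hy.pow 2))).add
      ((hu.const_mul p₂).mul hy)).add (((hu.pow 2).const_mul p₃).mul hy)).add
      ((hy.pow 3).const_mul p₄)
    refine (this.congr_fderiv ?_)
    ext <;> simp
  · have := (((((((hu.add ((hu.pow 2).const_mul q₁)).add ((hu.pow 3).const_mul q₂)).add
      ((hu.const_mul q₃).mul hy)).add (((hu.pow 2).const_mul q₄).mul hy)).add
      ((hy.pow 2).const_mul q₅)).add ((hu.const_mul q₆).mul (hy.pow 2)))).add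
      ((hy.pow 3).const_mul q₇)
    refine (this.congr_fderiv ?_)
    ext <;> simp

/-- The sign `σ = ±1` allows a half-rotation about `p`, so one normal form serves for both fields at
both points. -/
theorem isNilpotentSingularPoint_of_nil (hα : 0 ≤ α)
    (h : 0 < α ∨ (p₂ - 2 * q₅) ^ 2 + 8 * p₄ < 0) {Z : ℝ × ℝ → ℝ × ℝ} {p : ℝ × ℝ} {σ : ℝ}
    (hσ : σ * σ = 1)
    (hZ : ∀ u y, Z (p + σ • (u, y)) =
      σ • (nilFst α p₁ p₂ p₃ p₄ u y, nilSnd q₁ q₂ q₃ q₄ q₅ q₆ q₇ u y)) :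
    IsNilpotentSingularPoint Z p := by
  have hσ0 : σ ≠ 0 := by rintro rfl; simp at hσ
  set N : ℝ × ℝ → ℝ × ℝ := fun q ↦ (nilFst α p₁ p₂ p₃ p₄ q.1 q.2,
      nilSnd q₁ q₂ q₃ q₄ q₅ q₆ q₇ q.1 q.2)
  have hZ' : Z = fun q ↦ σ • N (σ • (q - p)) := by
    funext q
    have := hZ (σ • (q - p)).1 (σ • (q - p)).2
    rw [Prod.mk.eta, smul_smul, hσ, one_smul, add_sub_cancel] at this
    exact this
  set A := (0 : ℝ × ℝ →L[ℝ] ℝ).prod (ContinuousLinearMap.fst ℝ ℝ ℝ)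
  refine ⟨?_, ?_, A, ?_, ⟨2, ?_⟩, ?_⟩
  · rw [hZ']; simp [N, nilFst, nilSnd]
  · obtain ⟨r, hr, hiso⟩ := nil_isolated (p₁ := p₁) (p₃ := p₃) (q₁ := q₁) (q₂ := q₂)
      (q₃ := q₃) (q₄ := q₄) (q₆ := q₆) (q₇ := q₇) hα h
    have hc : Continuous fun q : ℝ × ℝ ↦ σ • (q - p) := by fun_prop
    have h1 : ∀ᶠ q in 𝓝 p, |(σ • (q - p)).1| < r :=
      (continuous_abs.comp hc.fst).continuousAt.eventually_lt continuousAt_const (by simpa using hr)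
    have h2 : ∀ᶠ q in 𝓝 p, |(σ • (q - p)).2| < r :=
      (continuous_abs.comp hc.snd).continuousAt.eventually_lt continuousAt_const (by simpa using hr)
    filter_upwards [h1.filter_mono nhdsWithin_le_nhds, h2.filter_mono nhdsWithin_le_nhds,
      self_mem_nhdsWithin] with q hq1 hq2 hq hq0
    rw [hZ'] at hq0
    have hN : N (σ • (q - p)) = 0 := (smul_eq_zero.1 hq0).resolve_left hσ0
    obtain ⟨h3, h4⟩ := hiso _ _ hq1.le hq2.le (congrArg Prod.fst hN) (congrArg Prod.snd hN)
    have h5 : σ • (q - p) = 0 := Prod.ext h3 h4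
    exact hq (sub_eq_zero.1 ((smul_eq_zero.1 h5).resolve_left hσ0))
  · rw [hZ']
    have h1 : HasFDerivAt (fun q : ℝ × ℝ ↦ σ • (q - p))
        (σ • ContinuousLinearMap.id ℝ (ℝ × ℝ)) p :=
      ((hasFDerivAt_id p).sub_const p).const_smul σ
    have h2 : HasFDerivAt N A (σ • (p - p)) := by
      rw [sub_self, smul_zero]; exact hasFDerivAt_nil
    refine ((h2.comp p h1).const_smul σ).congr_fderiv ?_
    ext <;> simp [A, hσ]
  · ext <;> simp [A, pow_two]
  · intro hA
    have := congrArg (fun B : ℝ × ℝ →L[ℝ] ℝ × ℝ ↦ (B (1, 0)).2) hA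
    simp [A] at this

end Nilpotent

end Closing

/-! ### The glued cubic field and its four closing mechanisms. -/

section CubicField

open Set Filter Topology Bornology NNReal

theorem hasDerivAt_mul_abs (y : ℝ) : HasDerivAt (fun y : ℝ ↦ y * |y|) (2 * |y|) y := by
  rcases lt_trichotomy y 0 with h | h | h
  · have h1 : HasDerivAt (fun y : ℝ ↦ -y ^ 2) (2 * |y|) y := by
      refine ((hasDerivAt_pow 2 y).neg).congr_deriv ?_
      rw [abs_of_neg h]; norm_num
    refine h1.congr_of_eventuallyEq ?_
    filter_upwards [gt_mem_nhds h] with z hz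
    rw [abs_of_neg hz]; ring
  · subst h
    rw [hasDerivAt_iff_tendsto_slope]
    have h1 : Tendsto (fun y : ℝ ↦ |y|) (𝓝[≠] 0) (𝓝 (2 * |0|)) := by
      have := (continuous_abs (G := ℝ)).tendsto 0
      simp only [abs_zero, mul_zero] at this ⊢
      exact this.mono_left nhdsWithin_le_nhds
    refine h1.congr' ?_
    filter_upwards [self_mem_nhdsWithin] with z hz
    rw [slope_def_field]
    field_simp [show z ≠ 0 from hz]
    simp
  · have h1 : HasDerivAt (fun y : ℝ ↦ y ^ 2) (2 * |y|) y := by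
      refine (hasDerivAt_pow 2 y).congr_deriv ?_
      rw [abs_of_pos h]; norm_num
    refine h1.congr_of_eventuallyEq ?_
    filter_upwards [lt_mem_nhds h] with z hz
    rw [abs_of_pos hz]; ring

/-- The switching term `±a₀₂ y²` is `a₀₂ y |y|`, so this is the regularity of the glued field. -/
theorem contDiff_mul_abs : ContDiff ℝ 1 fun y : ℝ ↦ y * |y| := by
  rw [contDiff_one_iff_deriv]
  refine ⟨fun y ↦ (hasDerivAt_mul_abs y).differentiableAt, ?_⟩
  have : deriv (fun y : ℝ ↦ y * |y|) = fun y ↦ 2 * |y| :=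
    funext fun y ↦ (hasDerivAt_mul_abs y).deriv
  rw [this]
  fun_prop

/-- The `C¹` vector field obtained by gluing the two fields of `cubicSystem` with `b₀₂ = 0`. -/
noncomputable def cubicField (a₀₂ a₀₃ a₁₂ a₂₁ b₀₃ b₁₂ b₂₁ : ℝ) (q : ℝ × ℝ) : ℝ × ℝ :=
  (-a₂₁ * q.2 + a₀₂ * (q.2 * |q.2|) + a₂₁ * q.1 ^ 2 * q.2 + a₁₂ * q.1 * q.2 ^ 2 + a₀₃ * q.2 ^ 3,
   -q.1 / 2 - b₂₁ * q.2 + q.1 ^ 3 / 2 + b₂₁ * q.1 ^ 2 * q.2 + b₁₂ * q.1 * q.2 ^ 2 + b₀₃ * q.2 ^ 3)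

section Field

variable (a₀₂ a₀₃ a₁₂ a₂₁ b₀₃ b₁₂ b₂₁ : ℝ)

theorem contDiff_cubicField : ContDiff ℝ 1 (cubicField a₀₂ a₀₃ a₁₂ a₂₁ b₀₃ b₁₂ b₂₁) := by
  have h : ContDiff ℝ 1 fun q : ℝ × ℝ ↦ q.2 * |q.2| := contDiff_mul_abs.comp contDiff_snd
  unfold cubicField
  fun_prop

/-- With `b₀₂ = 0` the two fields agree on the axis, and the Filippov segment shrinks to one vector.
-/
theorem velocities_cubicSystem (q : ℝ × ℝ) :
    (cubicSystem a₀₂ a₀₃ a₁₂ a₂₁ 0 b₀₃ b₁₂ b₂₁).velocities q =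
      {cubicField a₀₂ a₀₃ a₁₂ a₂₁ b₀₃ b₁₂ b₂₁ q} := by
  obtain ⟨x, y⟩ := q
  unfold SwitchingSystem.velocities
  rcases lt_trichotomy y 0 with h | h | h
  · simp only [h.not_gt, h, if_true, if_false, cubicSystem, cubicField, abs_of_neg h]
    congr 1; ext <;> simp only <;> ring
  · subst h
    simp only [lt_irrefl, if_false]
    have h1 : (cubicSystem a₀₂ a₀₃ a₁₂ a₂₁ 0 b₀₃ b₁₂ b₂₁).upper (x, 0) =
        cubicField a₀₂ a₀₃ a₁₂ a₂₁ b₀₃ b₁₂ b₂₁ (x, 0) := by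
      ext <;> simp [cubicSystem, cubicField]
    have h2 : (cubicSystem a₀₂ a₀₃ a₁₂ a₂₁ 0 b₀₃ b₁₂ b₂₁).lower (x, 0) =
        cubicField a₀₂ a₀₃ a₁₂ a₂₁ b₀₃ b₁₂ b₂₁ (x, 0) := by
      ext <;> simp [cubicSystem, cubicField]
    rw [h1, h2, segment_same]
  · simp only [h, if_true, cubicSystem, cubicField, abs_of_pos h]
    congr 1; ext <;> simp only <;> ring

theorem cubicField_upper {u y : ℝ} (hy : 0 ≤ y) :
    cubicField a₀₂ a₀₃ a₁₂ a₂₁ b₀₃ b₁₂ b₂₁ (1 + u, y) =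
      (nilFst (-(a₀₂ + a₁₂)) a₁₂ (2 * a₂₁) a₂₁ a₀₃ u y,
       nilSnd (3 / 2) (1 / 2) (2 * b₂₁) b₂₁ b₁₂ b₁₂ b₀₃ u y) := by
  ext <;> simp only [cubicField, nilFst, nilSnd, abs_of_nonneg hy] <;> ring

/-- A half-rotation about `(1, 0)` moves the lower half-plane to the upper one, so the same
half-turn analysis applies, now with `α = a₁₂ - a₀₂`. -/
theorem cubicField_lower {u y : ℝ} (hy : 0 ≤ y) :
    -cubicField a₀₂ a₀₃ a₁₂ a₂₁ b₀₃ b₁₂ b₂₁ (1 - u, -y) =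
      (nilFst (a₁₂ - a₀₂) a₁₂ (-2 * a₂₁) a₂₁ a₀₃ u y,
       nilSnd (-3 / 2) (1 / 2) (-2 * b₂₁) b₂₁ (-b₁₂) b₁₂ b₀₃ u y) := by
  ext <;> simp only [cubicField, nilFst, nilSnd, abs_neg, abs_of_nonneg hy, Prod.neg_mk] <;> ring

end Field

/-- Closing lemma for fields with a first integral in each half-plane. -/
theorem closesUp_of_firstIntegral {X : ℝ × ℝ → ℝ × ℝ} {r : ℝ} (hr : r ≤ 1) {F₁ F₂ : ℝ → ℝ → ℝ}
    (hF : ∀ x, F₁ x 0 = F₂ x 0)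
    (h₁ : ∀ (x y : ℝ → ℝ) t, |x t - 1| ≤ r → |y t| ≤ r → 0 ≤ y t →
      HasDerivAt x (X (x t, y t)).1 t → HasDerivAt y (X (x t, y t)).2 t →
      HasDerivAt (fun t ↦ F₁ (x t) (y t)) 0 t)
    (h₂ : ∀ (x y : ℝ → ℝ) t, |x t - 1| ≤ r → |y t| ≤ r → y t ≤ 0 →
      HasDerivAt x (X (x t, y t)).1 t → HasDerivAt y (X (x t, y t)).2 t →
      HasDerivAt (fun t ↦ F₂ (x t) (y t)) 0 t)
    (hinj : InjOn (fun x ↦ F₁ x 0) (Ioc 1 (1 + r))) : ClosesUp X r := by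
  intro Y K _ hYX γ hγ t₁ T hup hlo hsmall
  have hX : ∀ t ∈ Icc 0 T, HasDerivAt γ (X ((γ t).1, (γ t).2)) t := by
    intro t ht
    obtain ⟨h1, h2⟩ := hsmall t ht
    have := hYX (γ t) (by rw [abs_le] at *; constructor <;> linarith) (by linarith)
    rw [Prod.mk.eta, ← this]
    exact hγ t
  have h0T : (0 : ℝ) ≤ T := hup.lt.le.trans hlo.lt.le
  refine closing_of_firstIntegral hup hlo hF (fun t ht ↦ ?_) (fun t ht ↦ ?_) fun h0 hT h ↦ ?_
  · have htT : t ∈ Icc 0 T := ⟨ht.1, ht.2.trans hlo.lt.le⟩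
    have hy : 0 ≤ (γ t).2 := by
      rcases ht.1.eq_or_lt with h | h
      · rw [← h]; exact hup.y_left.ge
      rcases ht.2.eq_or_lt with h' | h'
      · rw [h']; exact hup.y_right.ge
      · exact (hup.y_pos t ⟨h, h'⟩).le
    exact h₁ _ _ t (hsmall t htT).1 (hsmall t htT).2 hy (hX t htT).fst_prod (hX t htT).snd_prod
  · have htT : t ∈ Icc 0 T := ⟨hup.lt.le.trans ht.1, ht.2⟩
    have hy : 0 ≤ -(γ t).2 := by
      rcases ht.1.eq_or_lt with h | h
      · rw [← h]; exact hlo.y_left.ge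
      rcases ht.2.eq_or_lt with h' | h'
      · rw [h']; exact hlo.y_right.ge
      · exact (hlo.y_pos t ⟨h, h'⟩).le
    exact h₂ _ _ t (hsmall t htT).1 (hsmall t htT).2 (by linarith) (hX t htT).fst_prod
      (hX t htT).snd_prod
  · have hm0 := (abs_le.1 (hsmall 0 ⟨le_rfl, h0T⟩).1).2
    have hmT := (abs_le.1 (hsmall T ⟨h0T, le_rfl⟩).1).2
    exact hinj ⟨hT, by linarith⟩ ⟨h0, by linarith⟩ h

/-- Hamiltonian of the fields of `cubicSystem` of divergence zero; `s = 1` in the upper and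
`s = -1` in the lower half-plane. -/
noncomputable def cubicHamiltonian (a₀₂ a₀₃ a₁₂ a₂₁ s x y : ℝ) : ℝ :=
  (x ^ 2 - 1) ^ 2 / 8 - a₂₁ * (x ^ 2 - 1) * y ^ 2 / 2 - (a₁₂ * x + s * a₀₂) * y ^ 3 / 3
    - a₀₃ * y ^ 4 / 4

theorem hasDerivAt_cubicHamiltonian {a₀₂ a₀₃ a₁₂ a₂₁ s : ℝ} {x y : ℝ → ℝ} {dx dy t : ℝ}
    (hx : HasDerivAt x dx t) (hy : HasDerivAt y dy t) :
    HasDerivAt (fun t ↦ cubicHamiltonian a₀₂ a₀₃ a₁₂ a₂₁ s (x t) (y t))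
      ((x t * (x t ^ 2 - 1) / 2 - a₂₁ * x t * y t ^ 2 - a₁₂ * y t ^ 3 / 3) * dx -
        (a₂₁ * (x t ^ 2 - 1) * y t + (a₁₂ * x t + s * a₀₂) * y t ^ 2 + a₀₃ * y t ^ 3) * dy) t := by
  have hw := (hx.fun_pow 2).sub_const 1
  have := ((((hw.fun_pow 2).div_const 8).sub (((hw.const_mul a₂₁).mul (hy.fun_pow 2)).div_const 2)).sub
    ((((hx.const_mul a₁₂).add_const (s * a₀₂)).mul (hy.fun_pow 3)).div_const 3)).sub
    (((hy.fun_pow 4).const_mul a₀₃).div_const 4)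
  refine this.congr_deriv ?_
  norm_num
  ring

/-- The coefficients make both divergences vanish. On the axis both Hamiltonians equal `(x² - 1)² /
8`, which is injective for `x > 1`. -/
theorem closesUp_hamiltonian (a₀₂ a₀₃ a₁₂ a₂₁ : ℝ) :
    ClosesUp (cubicField a₀₂ a₀₃ a₁₂ a₂₁ (-a₁₂ / 3) (-a₂₁) 0) 1 := by
  refine closesUp_of_firstIntegral le_rfl (F₁ := cubicHamiltonian a₀₂ a₀₃ a₁₂ a₂₁ 1)
    (F₂ := cubicHamiltonian a₀₂ a₀₃ a₁₂ a₂₁ (-1)) (fun x ↦ by simp [cubicHamiltonian])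
    (fun x y t _ _ h0 hx hy ↦ ?_) (fun x y t _ _ h0 hx hy ↦ ?_) ?_
  · refine (hasDerivAt_cubicHamiltonian hx hy).congr_deriv ?_
    simp only [cubicField, abs_of_nonneg h0]
    ring
  · refine (hasDerivAt_cubicHamiltonian hx hy).congr_deriv ?_
    simp only [cubicField, abs_of_nonpos h0]
    ring
  · intro x hx z hz h
    simp only [cubicHamiltonian] at h
    have hx1 : 0 < x ^ 2 - 1 := by nlinarith [hx.1]
    have hz1 : 0 < z ^ 2 - 1 := by nlinarith [hz.1]
    have h2 : x ^ 2 - 1 = z ^ 2 - 1 :=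
      (pow_left_inj₀ hx1.le hz1.le (by norm_num : (2 : ℕ) ≠ 0)).1 (by linarith)
    exact (pow_left_inj₀ (by linarith [hx.1]) (by linarith [hz.1]) (by norm_num : (2 : ℕ) ≠ 0)).1
      (by linarith)

/-- The first component is odd in `y` and the second even, so reflection in the axis reverses time.
-/
theorem closesUp_mirror (a₀₂ a₀₃ a₂₁ b₁₂ : ℝ) :
    ClosesUp (cubicField a₀₂ a₀₃ 0 a₂₁ 0 b₁₂ 0) 1 := by
  intro Y K hY hYX γ hγ t₁ T hup hlo hsmall
  refine closing_of_reversible hY hγ hup hlo (R := fun q ↦ (q.1, -q.2)) (g := fun _ ↦ 1)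
    continuousOn_const (fun _ _ ↦ one_pos) (fun t ht ↦ ?_) ?_ ?_ fun t ht ↦ ?_
  · obtain ⟨h1, h2⟩ := hsmall t ⟨ht.1, ht.2.trans hlo.lt.le⟩
    have h1' : |(γ t).1| ≤ 3 := by rw [abs_le] at *; constructor <;> linarith
    have hd := hγ t
    rw [hYX _ h1' (by linarith)] at hd
    rw [hYX ((γ t).1, -(γ t).2) h1' (by rw [abs_neg]; linarith)]
    refine (hd.fst_prod.prodMk hd.snd_prod.neg).congr_deriv ?_
    ext <;> simp only [cubicField, abs_neg, Prod.smul_mk, smul_eq_mul] <;> ring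
  · have : (γ 0).2 = 0 := hup.y_left
    ext <;> simp [this]
  · have : (γ t₁).2 = 0 := hup.y_right
    ext <;> simp [this]
  · have := hup.y_pos t ht
    simpa using this

theorem exists_box_of_nhds {P : ℝ × ℝ → Prop} {p : ℝ × ℝ} (h : ∀ᶠ q in 𝓝 p, P q) :
    ∃ r > 0, ∀ q : ℝ × ℝ, |q.1 - p.1| ≤ r → |q.2 - p.2| ≤ r → P q := by
  obtain ⟨r, hr, hP⟩ := Metric.eventually_nhds_iff.1 h
  refine ⟨r / 2, by positivity, fun q h1 h2 ↦ hP ?_⟩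
  rw [Prod.dist_eq, Real.dist_eq, Real.dist_eq]
  exact max_lt (by linarith) (by linarith)

/-- Field with the invariant curves `x + μ y = 0` and
`(x - ν y) (x² - μ ν y² - (3μ + ν) / (μ + ν)) + 2/3 μ ν (μ - ν) y³ = 0`. -/
theorem closesUp_darboux {μ ν : ℝ} (hμ : μ ≠ 0) (hκ : 0 < ν / μ) :
    ∃ r > 0, ClosesUp (cubicField 0 (-(μ ^ 2 * ν * (μ - ν) / 3) - μ ^ 2 * ν ^ 2 / 2) 0 (μ * ν / 2)
      (-(μ * ν * (μ - ν) / 6)) (-(μ * ν / 2)) ((μ - ν) / 2)) r := by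
  set κ := ν / μ with hκdef
  have hν : ν = κ * μ := by rw [hκdef]; field_simp
  have hκ1 : 1 + κ ≠ 0 := by positivity
  have hsum : μ + ν = μ * (1 + κ) := by rw [hν]; ring
  have hsum0 : μ + ν ≠ 0 := by rw [hsum]; exact mul_ne_zero hμ hκ1
  set G := (3 * μ + ν) / (μ + ν) with hG
  have hGκ : G = (3 + κ) / (1 + κ) := by rw [hG, hsum, hν]; field_simp
  have hG' : (μ + ν) * G = 3 * μ + ν := by rw [hG]; field_simp
  have hGκ' : (1 + κ) * G = 3 + κ := by rw [hGκ]; field_simp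
  have hG1 : 1 < G := by rw [hGκ, lt_div_iff₀ (by positivity)]; linarith
  set f : ℝ × ℝ → ℝ := fun q ↦ q.1 + μ * q.2
  set k : ℝ × ℝ → ℝ := fun q ↦ (q.1 - ν * q.2) * (q.1 ^ 2 - μ * ν * q.2 ^ 2 - G) +
    2 / 3 * μ * ν * (μ - ν) * q.2 ^ 3
  have hf : Continuous f := by simp only [f]; fun_prop
  have hk : Continuous k := by simp only [k]; fun_prop
  have hev : ∀ᶠ q in 𝓝 ((1, 0) : ℝ × ℝ), f q ≠ 0 ∧ k q ≠ 0 ∧ q.1 ^ 2 < G := by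
    refine (hf.continuousAt.eventually_ne (by simp [f])).and
      ((hk.continuousAt.eventually_ne (by simp [k]; linarith)).and ?_)
    exact (continuous_fst.pow 2).continuousAt.eventually_lt continuousAt_const (by simpa using hG1)
  obtain ⟨r₀, hr₀, hbox⟩ := exists_box_of_nhds hev
  simp only [sub_zero] at hbox
  refine ⟨min r₀ 1, by positivity, ?_⟩
  -- The invariant curves `f = 0` and `k = 0` have cofactors in the ratio `μ : -ν`, so `f ^ κ * k`
  -- is a first integral. Near `(1, 0)` the factor `k` is negative; `Real.log` then means the
  -- logarithm of its absolute value.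
  have hderiv : ∀ (x y : ℝ → ℝ) (t : ℝ), |x t - 1| ≤ min r₀ 1 → |y t| ≤ min r₀ 1 →
      HasDerivAt x (cubicField 0 (-(μ ^ 2 * ν * (μ - ν) / 3) - μ ^ 2 * ν ^ 2 / 2) 0 (μ * ν / 2)
        (-(μ * ν * (μ - ν) / 6)) (-(μ * ν / 2)) ((μ - ν) / 2) (x t, y t)).1 t →
      HasDerivAt y (cubicField 0 (-(μ ^ 2 * ν * (μ - ν) / 3) - μ ^ 2 * ν ^ 2 / 2) 0 (μ * ν / 2)
        (-(μ * ν * (μ - ν) / 6)) (-(μ * ν / 2)) ((μ - ν) / 2) (x t, y t)).2 t →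
      HasDerivAt (fun t ↦ κ * Real.log (f (x t, y t)) + Real.log (k (x t, y t))) 0 t := by
    intro x y t hx1 hy1 hx hy
    obtain ⟨hf0, hk0, -⟩ := hbox (x t, y t) (hx1.trans (min_le_left _ _))
      (hy1.trans (min_le_left _ _))
    have hdf : HasDerivAt (fun t ↦ f (x t, y t))
        (μ / 2 * (x t ^ 2 - 1 - μ * ν * y t ^ 2) * f (x t, y t)) t := by
      refine (hx.add (hy.const_mul μ)).congr_deriv ?_
      simp only [cubicField, f]
      ring
    have hdk : HasDerivAt (fun t ↦ k (x t, y t))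
        (-(ν / 2) * (x t ^ 2 - 1 - μ * ν * y t ^ 2) * k (x t, y t)) t := by
      refine (((hx.sub (hy.const_mul ν)).mul (((hx.fun_pow 2).sub
        ((hy.fun_pow 2).const_mul (μ * ν))).sub_const G)).add
        ((hy.fun_pow 3).const_mul (2 / 3 * μ * ν * (μ - ν)))).congr_deriv ?_
      simp only [cubicField, k]
      norm_num
      linear_combination (1 / 3 * μ * ν * (μ - ν) * y t ^ 3) * hG'
    refine (((hdf.log hf0).const_mul κ).add (hdk.log hk0)).congr_deriv ?_
    rw [mul_div_cancel_right₀ _ hf0, mul_div_cancel_right₀ _ hk0, hν]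
    ring
  refine closesUp_of_firstIntegral (min_le_right _ _)
    (F₁ := fun x y ↦ κ * Real.log (f (x, y)) + Real.log (k (x, y)))
    (F₂ := fun x y ↦ κ * Real.log (f (x, y)) + Real.log (k (x, y))) (fun _ ↦ rfl)
    (fun x y t h1 h2 _ hx hy ↦ hderiv x y t h1 h2 hx hy)
    (fun x y t h1 h2 _ hx hy ↦ hderiv x y t h1 h2 hx hy) ?_
  -- By the choice of `G` the derivative on the axis vanishes at `x = 1`; its numerator is a
  -- positive multiple of `x² - 1` and its denominator is negative while `x² < G`.
  have hanti : StrictAntiOn (fun x : ℝ ↦ κ * Real.log x + Real.log (x * (x ^ 2 - G)))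
      (Ioc 1 (1 + min r₀ 1)) := by
    have hne : ∀ x ∈ Ioc 1 (1 + min r₀ 1), x ^ 2 < G := fun x hx ↦
      (hbox (x, 0) (by
        rw [abs_of_nonneg (by linarith [hx.1])]
        linarith [hx.2, min_le_left r₀ 1]) (by simpa using hr₀.le)).2.2
    have hd : ∀ x ∈ Ioc 1 (1 + min r₀ 1),
        HasDerivAt (fun x : ℝ ↦ κ * Real.log x + Real.log (x * (x ^ 2 - G)))
          ((3 + κ) * (x ^ 2 - 1) / (x * (x ^ 2 - G))) x := by
      intro x hx
      have hx0 : x ≠ 0 := by linarith [hx.1]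
      have hxG : x ^ 2 - G ≠ 0 := by linarith [hne x hx]
      have h1 : HasDerivAt (fun x : ℝ ↦ x * (x ^ 2 - G)) (1 * (x ^ 2 - G) + x * (2 * x)) x := by
        refine ((hasDerivAt_id x).mul ((hasDerivAt_pow 2 x).sub_const G)).congr_deriv ?_
        simp
      refine (((Real.hasDerivAt_log hx0).const_mul κ).add
        (h1.log (mul_ne_zero hx0 hxG))).congr_deriv ?_
      field_simp
      linear_combination -hGκ'
    refine strictAntiOn_of_hasDerivWithinAt_neg (convex_Ioc _ _)
      (fun x hx ↦ (hd x hx).continuousAt.continuousWithinAt)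
      (fun x hx ↦ (hd x (interior_subset hx)).hasDerivWithinAt) fun x hx ↦ ?_
    have hx' := interior_subset hx
    have := hne x hx'
    apply div_neg_of_pos_of_neg
    · have : 0 < x ^ 2 - 1 := by nlinarith [hx'.1]
      positivity
    · exact mul_neg_of_pos_of_neg (by linarith [hx'.1]) (by linarith)
  refine hanti.injOn.congr fun x _ ↦ ?_
  simp [f, k]

/-- This is the chain rule for the fold, `d` being the derivative of `h²` along `v`. Multiplying by
`h` leaves only `h²`, and `e1` and `e2` become polynomial identities modulo its defining relation.
-/
theorem fold_identity {x y b β h d : ℝ} {v : ℝ × ℝ} (hD : 2 * x + 3 * b * y ≠ 0) (hh : h ≠ 0)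
    (hsq : h ^ 2 * (2 * x + 3 * b * y) = 2 * x - b * y)
    (hd : d * (2 * x + 3 * b * y) ^ 2 = (2 * v.1 - b * v.2) * (2 * x + 3 * b * y) -
      (2 * x - b * y) * (2 * v.1 + 3 * b * v.2))
    (hv : v = cubicField 0 (3 * b ^ 2 * (4 * β + b ^ 2) / 16) 0 (-3 * b ^ 2 / 8)
      (b * (8 * β - b ^ 2) / 8) β b (x, y)) :
    (d / (2 * h) * (x + b * y) + h * (v.1 + b * v.2), -(d / (2 * h) * y + h * v.2)) =
      -(1 / h ^ 2) • cubicField 0 (3 * b ^ 2 * (4 * β + b ^ 2) / 16) 0 (-3 * b ^ 2 / 8)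
        (b * (8 * β - b ^ 2) / 8) β b (h * (x + b * y), -(h * y)) := by
  have hD2 : (2 * x + 3 * b * y) ^ 2 ≠ 0 := pow_ne_zero 2 hD
  have e1 : d * (x + b * y) / 2 + h ^ 2 * (v.1 + b * v.2) =
      y * (-3 * b ^ 2 / 8 * (h ^ 2 * (x + b * y) ^ 2 - 1) +
        3 * b ^ 2 * (4 * β + b ^ 2) / 16 * h ^ 2 * y ^ 2) := by
    apply mul_right_cancel₀ hD2
    rw [hv] at hd ⊢
    simp only [cubicField] at hd ⊢
    linear_combination ((x + b * y) / 2) * hd + ((2 * x + 3 * b * y) *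
      ((-(-3 * b ^ 2 / 8) * y + 0 * (y * |y|) + -3 * b ^ 2 / 8 * x ^ 2 * y + 0 * x * y ^ 2 +
        3 * b ^ 2 * (4 * β + b ^ 2) / 16 * y ^ 3) + b * (-x / 2 - b * y + x ^ 3 / 2 +
        b * x ^ 2 * y + β * x * y ^ 2 + b * (8 * β - b ^ 2) / 8 * y ^ 3)) -
      y * (2 * x + 3 * b * y) * (-3 * b ^ 2 / 8 * (x + b * y) ^ 2 +
        3 * b ^ 2 * (4 * β + b ^ 2) / 16 * y ^ 2)) * hsq
  have e2 : d * y / 2 + h ^ 2 * v.2 =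
      -(x + b * y) / 2 + b * y + h ^ 2 * ((x + b * y) ^ 3 / 2 - b * (x + b * y) ^ 2 * y +
        β * (x + b * y) * y ^ 2 - b * (8 * β - b ^ 2) / 8 * y ^ 3) := by
    apply mul_right_cancel₀ hD2
    rw [hv] at hd ⊢
    simp only [cubicField] at hd ⊢
    linear_combination (y / 2) * hd + ((2 * x + 3 * b * y) *
      (-x / 2 - b * y + x ^ 3 / 2 + b * x ^ 2 * y + β * x * y ^ 2 +
        b * (8 * β - b ^ 2) / 8 * y ^ 3 - ((x + b * y) ^ 3 / 2 - b * (x + b * y) ^ 2 * y +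
        β * (x + b * y) * y ^ 2 - b * (8 * β - b ^ 2) / 8 * y ^ 3))) * hsq
  ext
  · simp only [cubicField, Prod.smul_mk, smul_eq_mul]
    field_simp
    linear_combination 256 * e1
  · simp only [cubicField, Prod.smul_mk, smul_eq_mul]
    field_simp
    linear_combination -16 * e2

/-- Field that is reversible with respect to
`(x, y) ↦ √((2 x - b y) / (2 x + 3 b y)) • (x + b y, -y)`. -/
theorem closesUp_fold (b β : ℝ) :
    ∃ r > 0, ClosesUp (cubicField 0 (3 * b ^ 2 * (4 * β + b ^ 2) / 16) 0 (-3 * b ^ 2 / 8)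
      (b * (8 * β - b ^ 2) / 8) β b) r := by
  refine ⟨min (1 / 4) (1 / (8 * (|b| + 1))), by positivity, ?_⟩
  intro Y K hY hYX γ hγ t₁ T hup hlo hsmall
  -- The fold replaces `ρ` by `1 / ρ`, so it is an involution; `ρ = 1` on the axis, whose points it
  -- fixes. The radius gives `|b * y| ≤ 1 / 8`, which keeps numerator and denominator positive.
  set ρ : ℝ × ℝ → ℝ := fun q ↦ (2 * q.1 - b * q.2) / (2 * q.1 + 3 * b * q.2)
  have hγc : Continuous γ := continuous_iff_continuousAt.2 fun t ↦ (hγ t).continuousAt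
  have hbd : ∀ t ∈ Icc 0 t₁, |(γ t).1 - 1| ≤ 1 / 4 ∧ |(γ t).2| ≤ 1 / 4 ∧
      |b * (γ t).2| ≤ 1 / 8 := by
    intro t ht
    obtain ⟨h1, h2⟩ := hsmall t ⟨ht.1, ht.2.trans hlo.lt.le⟩
    refine ⟨h1.trans (min_le_left _ _), h2.trans (min_le_left _ _), ?_⟩
    have h3 := h2.trans (min_le_right _ _)
    rw [le_div_iff₀ (by positivity)] at h3
    rw [abs_mul]
    nlinarith [abs_nonneg b, abs_nonneg (γ t).2]
  have hnum : ∀ t ∈ Icc 0 t₁, 0 < 2 * (γ t).1 - b * (γ t).2 := fun t ht ↦ by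
    obtain ⟨h1, -, h3⟩ := hbd t ht
    rw [abs_le] at h1 h3; linarith
  have hden : ∀ t ∈ Icc 0 t₁, 0 < 2 * (γ t).1 + 3 * b * (γ t).2 := fun t ht ↦ by
    obtain ⟨h1, -, h3⟩ := hbd t ht
    rw [abs_le] at h1 h3; linarith
  have hρpos : ∀ t ∈ Icc 0 t₁, 0 < ρ (γ t) := fun t ht ↦ div_pos (hnum t ht) (hden t ht)
  have hfix : ∀ q : ℝ × ℝ, q.2 = 0 → q.1 ≠ 0 →
      (√(ρ q) * (q.1 + b * q.2), -(√(ρ q) * q.2)) = q := by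
    intro q hq hq1
    have : ρ q = 1 := by simp only [ρ, hq]; field_simp; simp
    ext <;> simp [this, hq]
  refine closing_of_reversible hY hγ hup hlo
    (R := fun q ↦ (√(ρ q) * (q.1 + b * q.2), -(√(ρ q) * q.2))) (g := fun t ↦ 1 / ρ (γ t)) ?_
    (fun t ht ↦ one_div_pos.2 (hρpos t ht)) (fun t ht ↦ ?_) ?_ ?_ fun t ht ↦ ?_
  · refine continuousOn_const.div (ContinuousOn.div ?_ ?_ fun t ht ↦ (hden t ht).ne')
      fun t ht ↦ (hρpos t ht).ne'
    · fun_prop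
    · fun_prop
  · obtain ⟨h1, h2, h3⟩ := hbd t ht
    have hn := hnum t ht
    have hd := hden t ht
    have hr := hρpos t ht
    have hγ' := hγ t
    rw [hYX _ (by rw [abs_le] at *; constructor <;> linarith) (by linarith)] at hγ'
    have hx := hγ'.fst_prod
    have hy := hγ'.snd_prod
    set v := cubicField 0 (3 * b ^ 2 * (4 * β + b ^ 2) / 16) 0 (-3 * b ^ 2 / 8)
      (b * (8 * β - b ^ 2) / 8) β b (γ t) with hv
    obtain ⟨d, hd_eq⟩ : ∃ d, d = ((2 * v.1 - b * v.2) * (2 * (γ t).1 + 3 * b * (γ t).2) -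
      (2 * (γ t).1 - b * (γ t).2) * (2 * v.1 + 3 * b * v.2)) /
        (2 * (γ t).1 + 3 * b * (γ t).2) ^ 2 := ⟨_, rfl⟩
    have hdρ : HasDerivAt (fun t ↦ ρ (γ t)) d t := by
      rw [hd_eq]
      exact ((hx.const_mul 2).sub (hy.const_mul b)).div
        ((hx.const_mul 2).add (hy.const_mul (3 * b))) hd.ne'
    have hds : HasDerivAt (fun t ↦ √(ρ (γ t))) (d / (2 * √(ρ (γ t)))) t := hdρ.sqrt hr.ne'
    have hR : HasDerivAt
        (fun t ↦ (√(ρ (γ t)) * ((γ t).1 + b * (γ t).2), -(√(ρ (γ t)) * (γ t).2)))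
        (d / (2 * √(ρ (γ t))) * ((γ t).1 + b * (γ t).2) + √(ρ (γ t)) * (v.1 + b * v.2),
          -(d / (2 * √(ρ (γ t))) * (γ t).2 + √(ρ (γ t)) * v.2)) t :=
      (hds.mul (hx.add (hy.const_mul b))).prodMk (hds.mul hy).neg
    have hρ2 : ρ (γ t) ≤ 4 := by
      rw [div_le_iff₀ hd]; rw [abs_le] at h1 h3; linarith
    set h := √(ρ (γ t)) with hh
    have hpos : 0 < h := Real.sqrt_pos.2 hr
    have hsq : h ^ 2 = ρ (γ t) := Real.sq_sqrt hr.le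
    have hh2 : h ≤ 2 := by nlinarith
    have hin1 : |h * ((γ t).1 + b * (γ t).2)| ≤ 3 := by
      rw [abs_mul, abs_of_pos hpos]
      have : |(γ t).1 + b * (γ t).2| ≤ 3 / 2 := by
        rw [abs_le] at *; constructor <;> linarith
      nlinarith [abs_nonneg ((γ t).1 + b * (γ t).2)]
    have hin2 : |-(h * (γ t).2)| ≤ 3 := by
      rw [abs_neg, abs_mul, abs_of_pos hpos]
      nlinarith [abs_nonneg (γ t).2]
    rw [hYX (h * ((γ t).1 + b * (γ t).2), -(h * (γ t).2)) hin1 hin2]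
    refine hR.congr_deriv ?_
    rw [← hsq]
    refine fold_identity hd.ne' hpos.ne' (by rw [hsq]; exact div_mul_cancel₀ _ hd.ne') ?_ hv
    rw [hd_eq]
    exact div_mul_cancel₀ _ (pow_ne_zero 2 hd.ne')
  · exact hfix _ hup.y_left (by
      have h := hup.u_left
      intro h'
      norm_num [h'] at h)
  · obtain ⟨h1, -⟩ := hbd t₁ ⟨hup.lt.le, le_rfl⟩
    exact hfix _ hup.y_right (by
      rw [abs_le] at h1
      intro h'
      linarith)
  · have h1 := hup.y_pos t ht
    have h2 := Real.sqrt_pos.2 (hρpos t (Ioo_subset_Icc_self ht))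
    have := mul_pos h2 h1
    simp only
    linarith

end CubicField

/-! ### Transfer to the second point, and the six conditions. -/

section BiCenter

open Set Filter Topology Bornology NNReal

namespace SwitchingSystem

variable {S : SwitchingSystem}

theorem IsZTwoEquivariant.lower_neg (hS : S.IsZTwoEquivariant) (q : ℝ × ℝ) :
    S.lower (-q) = -S.upper q := by
  rw [← neg_neg (S.lower (-q)), ← hS (-q), neg_neg]

theorem IsZTwoEquivariant.neg_mem_velocities (hS : S.IsZTwoEquivariant) {q v : ℝ × ℝ}
    (hv : v ∈ S.velocities q) : -v ∈ S.velocities (-q) := by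
  unfold velocities at hv ⊢
  rcases lt_trichotomy q.2 0 with h | h | h
  · rw [if_neg h.not_gt, if_pos h, mem_singleton_iff] at hv
    rw [if_pos (by simpa using h), mem_singleton_iff, hv, hS]
  · rw [if_neg h.not_gt, if_neg h.not_lt] at hv
    rw [if_neg (by simp [h]), if_neg (by simp [h]), hS, hS.lower_neg, segment_symm]
    obtain ⟨a, b, ha, hb, hab, rfl⟩ := hv
    exact ⟨a, b, ha, hb, hab, by module⟩
  · rw [if_pos h, mem_singleton_iff] at hv
    rw [if_neg (by simpa using h.le), if_pos (by simpa using h), mem_singleton_iff, hv,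
      hS.lower_neg]

theorem IsZTwoEquivariant.isSolutionOn_neg (hS : S.IsZTwoEquivariant) {γ : ℝ → ℝ × ℝ} {J : Set ℝ}
    (h : S.IsSolutionOn γ J) : S.IsSolutionOn (fun t ↦ -γ t) J := by
  obtain ⟨v, hint, hvel⟩ := h
  refine ⟨fun t ↦ -v t, fun a ha b hb ↦ ⟨(hint a ha b hb).1.neg, ?_⟩, ?_⟩
  · rw [intervalIntegral.integral_neg, ← (hint a ha b hb).2]
    simp only [neg_sub, sub_neg_eq_add, neg_add_eq_sub]
  · filter_upwards [hvel] with t ht using hS.neg_mem_velocities ht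

theorem IsCenter.neg {p : ℝ × ℝ} (h : S.IsCenter p) (hS : S.IsZTwoEquivariant) :
    S.IsCenter (-p) := by
  obtain ⟨U, hU, hper⟩ := h
  refine ⟨Neg.neg ⁻¹' U, continuous_neg.continuousAt.preimage_mem_nhds (by rwa [neg_neg]),
    fun q hq hqp ↦ ?_⟩
  obtain ⟨γ, T, hT, hγT, hsol, h0, hγU, hp, hbdd, huniq⟩ :=
    hper (-q) hq fun h' ↦ hqp (by rw [← h', neg_neg])
  have himage : (range fun t ↦ -γ t) = Homeomorph.neg (ℝ × ℝ) '' range γ := by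
    rw [← range_comp]; rfl
  refine ⟨fun t ↦ -γ t, T, hT, fun t ↦ congrArg Neg.neg (hγT t), hS.isSolutionOn_neg hsol,
    neg_eq_iff_eq_neg.2 h0, ?_, ?_, ?_, fun J δ hJ hJ0 hδ hδ0 t ht ↦ ?_⟩
  · rintro _ ⟨t, rfl⟩
    simpa using hγU (mem_range_self t)
  · rintro ⟨t, ht⟩
    exact hp ⟨t, neg_injective ht⟩
  · rw [himage, ← image_compl_eq (Homeomorph.neg (ℝ × ℝ)).bijective]
    change IsBounded (connectedComponentIn _ (Homeomorph.neg (ℝ × ℝ) p))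
    rw [← (Homeomorph.neg (ℝ × ℝ)).image_connectedComponentIn hp]
    have := hbdd.neg
    rwa [← image_neg_eq_neg] at this
  · exact neg_eq_iff_eq_neg.1
      (huniq J (fun t ↦ -δ t) hJ hJ0 (hS.isSolutionOn_neg hδ) (congrArg Neg.neg hδ0) ht)

end SwitchingSystem

section Field

variable (a₀₂ a₀₃ a₁₂ a₂₁ b₀₃ b₁₂ b₂₁ : ℝ)

theorem isZTwoEquivariant_cubicSystem (b₀₂ : ℝ) :
    (cubicSystem a₀₂ a₀₃ a₁₂ a₂₁ b₀₂ b₀₃ b₁₂ b₂₁).IsZTwoEquivariant := by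
  rintro ⟨x, y⟩
  ext <;> simp only [cubicSystem, Prod.neg_mk] <;> ring

variable {a₀₂ a₀₃ a₁₂ a₂₁ b₀₃ b₁₂ b₂₁}

/-- A monodromic field of the family whose small trajectories close up has a bi-center. -/
theorem cubicSystem_biCenter_of_closesUp (hα : 0 ≤ -(a₀₂ + a₁₂)) (hα' : 0 ≤ a₁₂ - a₀₂)
    (h : 0 < -(a₀₂ + a₁₂) ∨ (a₂₁ - b₁₂) ^ 2 + 2 * a₀₃ < 0)
    (h' : 0 < a₁₂ - a₀₂ ∨ (a₂₁ - b₁₂) ^ 2 + 2 * a₀₃ < 0)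
    (hclose : ∃ r > 0, ClosesUp (cubicField a₀₂ a₀₃ a₁₂ a₂₁ b₀₃ b₁₂ b₂₁) r) :
    (∀ p ∈ ({(1, 0), (-1, 0)} : Set (ℝ × ℝ)),
      IsNilpotentSingularPoint (cubicSystem a₀₂ a₀₃ a₁₂ a₂₁ 0 b₀₃ b₁₂ b₂₁).upper p ∧
      IsNilpotentSingularPoint (cubicSystem a₀₂ a₀₃ a₁₂ a₂₁ 0 b₀₃ b₁₂ b₂₁).lower p) ∧
    (cubicSystem a₀₂ a₀₃ a₁₂ a₂₁ 0 b₀₃ b₁₂ b₂₁).HasBiCenter (1, 0) (-1, 0) := by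
  have h₁ : 0 < -(a₀₂ + a₁₂) ∨ (2 * a₂₁ - 2 * b₁₂) ^ 2 + 8 * a₀₃ < 0 :=
    h.imp_right fun h ↦ by linear_combination 4 * h
  have h₂ : 0 < a₁₂ - a₀₂ ∨ (-2 * a₂₁ - 2 * -b₁₂) ^ 2 + 8 * a₀₃ < 0 :=
    h'.imp_right fun h ↦ by linear_combination 4 * h
  refine ⟨?_, isZTwoEquivariant_cubicSystem _ _ _ _ _ _ _ _, ?_⟩
  · rintro p (rfl | rfl)
    · refine ⟨isNilpotentSingularPoint_of_nil (p₁ := a₁₂) (p₃ := a₂₁) (q₁ := 3 / 2)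
        (q₂ := 1 / 2) (q₃ := 2 * b₂₁) (q₄ := b₂₁) (q₆ := b₁₂) (q₇ := b₀₃) (σ := 1)
        hα h₁ (by norm_num) fun u y ↦ ?_,
        isNilpotentSingularPoint_of_nil (p₁ := a₁₂) (p₃ := a₂₁) (q₁ := -3 / 2)
        (q₂ := 1 / 2) (q₃ := -2 * b₂₁) (q₄ := b₂₁) (q₆ := b₁₂) (q₇ := b₀₃) (σ := -1)
        hα' h₂ (by norm_num) fun u y ↦ ?_⟩ <;>
      ext <;> simp only [cubicSystem, nilFst, nilSnd, Prod.smul_mk, Prod.mk_add_mk,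
        smul_eq_mul] <;> ring
    · refine ⟨isNilpotentSingularPoint_of_nil (p₁ := a₁₂) (p₃ := a₂₁) (q₁ := -3 / 2)
        (q₂ := 1 / 2) (q₃ := -2 * b₂₁) (q₄ := b₂₁) (q₆ := b₁₂) (q₇ := b₀₃) (σ := 1)
        hα' h₂ (by norm_num) fun u y ↦ ?_,
        isNilpotentSingularPoint_of_nil (p₁ := a₁₂) (p₃ := a₂₁) (q₁ := 3 / 2)
        (q₂ := 1 / 2) (q₃ := 2 * b₂₁) (q₄ := b₂₁) (q₆ := b₁₂) (q₇ := b₀₃) (σ := -1)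
        hα h₁ (by norm_num) fun u y ↦ ?_⟩ <;>
      ext <;> simp only [cubicSystem, nilFst, nilSnd, Prod.smul_mk, Prod.mk_add_mk,
        smul_eq_mul] <;> ring
  · obtain ⟨r, hr, hclose⟩ := hclose
    obtain ⟨ε₁, M₁, hup⟩ := nil_hasHalfTurns hα h₁ fun u y hy ↦
      cubicField_upper a₀₂ a₀₃ a₁₂ a₂₁ b₀₃ b₁₂ b₂₁ (u := u) (y := y) hy
    obtain ⟨ε₂, M₂, hlo⟩ := nil_hasHalfTurns hα' h₂ fun u y hy ↦
      cubicField_lower a₀₂ a₀₃ a₁₂ a₂₁ b₀₃ b₁₂ b₂₁ (u := u) (y := y) hy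
    have hcenter := SwitchingSystem.isCenter_of_halfTurns
      (contDiff_cubicField a₀₂ a₀₃ a₁₂ a₂₁ b₀₃ b₁₂ b₂₁)
      (velocities_cubicSystem a₀₂ a₀₃ a₁₂ a₂₁ b₀₃ b₁₂ b₂₁) hup hlo hr hclose
    refine ⟨hcenter, ?_⟩
    simpa using hcenter.neg (isZTwoEquivariant_cubicSystem _ _ _ _ _ _ _ _)

end Field

/-- From `μν = 2a` and `μ - ν = 2b` the third equation becomes `c + 2a² = -4abμ/3`, which determines
`μ`; `h` is then the remaining relation `2a = μ (μ - 2b)`. The hypotheses force `a > 0`, since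
otherwise both summands of `h` are nonnegative and the first is positive. Hence `ν / μ = 2a / μ² >
0`. -/
theorem exists_darboux_parameters {a b c : ℝ}
    (h : 9 * (c + 2 * a ^ 2) ^ 2 + 8 * a * b ^ 2 * (3 * c + 2 * a ^ 2) = 0)
    (hc : c + 2 * a ^ 2 < 0) :
    ∃ μ ν : ℝ, μ ≠ 0 ∧ 0 < ν / μ ∧ a = μ * ν / 2 ∧ b = (μ - ν) / 2 ∧
      c = -(μ ^ 2 * ν * (μ - ν) / 3) - μ ^ 2 * ν ^ 2 / 2 := by
  have hd : 0 < (c + 2 * a ^ 2) ^ 2 := sq_pos_of_neg hc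
  have ha : 0 < a := by
    by_contra! ha
    nlinarith [mul_nonneg (mul_nonneg (neg_nonneg.2 ha) (sq_nonneg b))
      (show 0 ≤ -(3 * c + 2 * a ^ 2) by nlinarith [sq_nonneg a])]
  have hb : b ≠ 0 := by rintro rfl; linarith
  have hμ : -(3 * (c + 2 * a ^ 2)) / (4 * a * b) ≠ 0 :=
    div_ne_zero (by linarith) (by positivity)
  obtain ⟨μ, hμd⟩ : ∃ μ, μ = -(3 * (c + 2 * a ^ 2)) / (4 * a * b) := ⟨_, rfl⟩
  rw [← hμd] at hμ
  have hab : 4 * a * b ≠ 0 := by positivity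
  have h1 : μ * (4 * a * b) = -(3 * (c + 2 * a ^ 2)) := by rw [hμd, div_mul_cancel₀ _ hab]
  have h2 : a = μ * (μ - 2 * b) / 2 := by
    apply mul_right_cancel₀ (pow_ne_zero 2 hab)
    linear_combination (-1 / 2 * (μ * (4 * a * b) - 3 * (c + 2 * a ^ 2)) + 4 * a * b ^ 2) * h1 -
      1 / 2 * h
  refine ⟨μ, μ - 2 * b, hμ, ?_, h2, by ring, ?_⟩
  · have : (μ - 2 * b) / μ = 2 * a / μ ^ 2 := by
      rw [h2]; field_simp
    rw [this]
    positivity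
  · linear_combination (1 / 3) * h1 - (4 / 3 * μ * b + 2 * a + μ * (μ - 2 * b)) * h2

/-- As a monic quadratic in `β`, the left-hand side has the two bounds as its roots. -/
theorem fold_discriminant_neg {b β : ℝ} (h₁ : -((9 + 4 * √3) / 8) * b ^ 2 < β)
    (h₂ : β < -((9 - 4 * √3) / 8) * b ^ 2) :
    (-3 * b ^ 2 / 8 - β) ^ 2 + 2 * (3 * b ^ 2 * (4 * β + b ^ 2) / 16) < 0 := by
  have h3 : √3 ^ 2 = 3 := Real.sq_sqrt (by norm_num)
  have h4 := mul_pos (sub_pos.2 h₁) (sub_pos.2 h₂)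
  linear_combination h4 + b ^ 4 / 4 * h3

end BiCenter

theorem theorem2p2 (a₀₂ a₀₃ a₁₂ a₂₁ b₀₂ b₀₃ b₁₂ b₂₁ : ℝ)
    (h :
      -- Condition I
      (a₀₂ + a₁₂ = 0 ∧ a₂₁ + b₁₂ = 0 ∧ a₁₂ + 3 * b₀₃ = 0 ∧ b₀₂ = 0 ∧ b₂₁ = 0 ∧
        0 < a₁₂ ∧ a₀₃ + 2 * a₂₁ ^ 2 < 0) ∨
      -- Condition II
      (a₀₂ = 0 ∧ a₁₂ = 0 ∧ b₀₂ = 0 ∧ b₀₃ = 0 ∧ b₂₁ = 0 ∧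
        2 * a₀₃ + (b₁₂ - a₂₁) ^ 2 < 0) ∨
      -- Condition III
      (a₀₂ = 0 ∧ a₁₂ = 0 ∧ b₀₂ = 0 ∧ a₂₁ + b₁₂ = 0 ∧ 3 * b₀₃ + 2 * a₂₁ * b₂₁ = 0 ∧
        9 * (a₀₃ + 2 * a₂₁ ^ 2) ^ 2 + 8 * a₂₁ * b₂₁ ^ 2 * (3 * a₀₃ + 2 * a₂₁ ^ 2) = 0 ∧
        a₀₃ + 2 * a₂₁ ^ 2 < 0) ∨
      -- Condition IV
      (a₀₂ = 0 ∧ a₁₂ = 0 ∧ b₀₂ = 0 ∧ 8 * a₂₁ + 3 * b₂₁ ^ 2 = 0 ∧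
        16 * a₀₃ - 3 * b₂₁ ^ 2 * (4 * b₁₂ + b₂₁ ^ 2) = 0 ∧
        8 * b₀₃ - b₂₁ * (8 * b₁₂ - b₂₁ ^ 2) = 0 ∧
        -((9 + 4 * Real.sqrt 3) / 8) * b₂₁ ^ 2 < b₁₂ ∧
        b₁₂ < -((9 - 4 * Real.sqrt 3) / 8) * b₂₁ ^ 2) ∨
      -- Condition V
      (a₁₂ = 0 ∧ b₀₂ = 0 ∧ b₀₃ = 0 ∧ b₂₁ = 0 ∧ a₀₂ < 0) ∨
      -- Condition VI
      (a₂₁ + b₁₂ = 0 ∧ a₁₂ + 3 * b₀₃ = 0 ∧ b₀₂ = 0 ∧ b₂₁ = 0 ∧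
        (a₀₂ + |a₁₂| < 0 ∨ (a₀₂ = a₁₂ ∧ a₁₂ < 0 ∧ a₀₃ + 2 * a₂₁ ^ 2 < 0)))) :
    (∀ p ∈ ({(1, 0), (-1, 0)} : Set (ℝ × ℝ)),
      IsNilpotentSingularPoint (cubicSystem a₀₂ a₀₃ a₁₂ a₂₁ b₀₂ b₀₃ b₁₂ b₂₁).upper p ∧
      IsNilpotentSingularPoint (cubicSystem a₀₂ a₀₃ a₁₂ a₂₁ b₀₂ b₀₃ b₁₂ b₂₁).lower p) ∧
    (cubicSystem a₀₂ a₀₃ a₁₂ a₂₁ b₀₂ b₀₃ b₁₂ b₂₁).HasBiCenter (1, 0) (-1, 0) := by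
  rcases h with ⟨h02, hb12, hb03, rfl, rfl, hpos, hneg⟩ | ⟨rfl, rfl, rfl, rfl, rfl, hneg⟩ |
    ⟨rfl, rfl, rfl, hb12, hb03, hinv, hneg⟩ | ⟨rfl, rfl, rfl, ha21, ha03, hb03, hlt, hgt⟩ |
    ⟨rfl, rfl, rfl, rfl, hneg⟩ | ⟨hb12, hb03, rfl, rfl, hcases⟩
  · obtain rfl : b₁₂ = -a₂₁ := by linarith
    obtain rfl : b₀₃ = -a₁₂ / 3 := by linarith
    -- Here `α` vanishes in the upper half-plane, which needs the discriminant, and equals `2 * a₁₂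
    -- > 0` in the lower one.
    exact cubicSystem_biCenter_of_closesUp (by linarith) (by linarith) (Or.inr (by linarith))
      (Or.inl (by linarith)) ⟨1, one_pos, closesUp_hamiltonian _ _ _ _⟩
  · have hdisc : (a₂₁ - b₁₂) ^ 2 + 2 * a₀₃ < 0 := by linarith
    exact cubicSystem_biCenter_of_closesUp (by simp) (by simp) (Or.inr hdisc) (Or.inr hdisc)
      ⟨1, one_pos, closesUp_mirror _ _ _ _⟩
  · obtain ⟨μ, ν, hμ, hκ, rfl, rfl, rfl⟩ := exists_darboux_parameters hinv hneg
    obtain rfl : b₁₂ = -(μ * ν / 2) := by linarith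
    obtain rfl : b₀₃ = -(μ * ν * (μ - ν) / 6) := by linarith
    exact cubicSystem_biCenter_of_closesUp (by simp) (by simp) (Or.inr (by linarith))
      (Or.inr (by linarith)) (closesUp_darboux hμ hκ)
  · obtain rfl : a₂₁ = -3 * b₂₁ ^ 2 / 8 := by linarith
    obtain rfl : a₀₃ = 3 * b₂₁ ^ 2 * (4 * b₁₂ + b₂₁ ^ 2) / 16 := by linarith
    obtain rfl : b₀₃ = b₂₁ * (8 * b₁₂ - b₂₁ ^ 2) / 8 := by linarith
    exact cubicSystem_biCenter_of_closesUp (by simp) (by simp)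
      (Or.inr (fold_discriminant_neg hlt hgt)) (Or.inr (fold_discriminant_neg hlt hgt))
      (closesUp_fold _ _)
  · exact cubicSystem_biCenter_of_closesUp (by linarith) (by linarith) (Or.inl (by linarith))
      (Or.inl (by linarith)) ⟨1, one_pos, closesUp_mirror _ _ _ _⟩
  · obtain rfl : b₁₂ = -a₂₁ := by linarith
    obtain rfl : b₀₃ = -a₁₂ / 3 := by linarith
    have hclose := closesUp_hamiltonian a₀₂ a₀₃ a₁₂ a₂₁
    rcases hcases with hneg | ⟨rfl, h12, hneg⟩
    · have h1 := le_abs_self a₁₂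
      have h2 := neg_abs_le a₁₂
      exact cubicSystem_biCenter_of_closesUp (by linarith) (by linarith) (Or.inl (by linarith))
        (Or.inl (by linarith)) ⟨1, one_pos, hclose⟩
    -- The boundary case `a₀₂ = a₁₂` is opposite to condition I: now `α` vanishes in the lower
    -- half-plane only.
    · exact cubicSystem_biCenter_of_closesUp (by linarith) (by linarith) (Or.inl (by linarith))
        (Or.inr (by linarith)) ⟨1, one_pos, hclose⟩
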